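/- Let $d \ge 2$ be an integer and let $s$ be a real number with $0 < 2s < d$. For $E \subseteq \mathbb{R}^d$ define the $(s,2)$-outer capacity $$R_{s,2}(E) := \inf\Big\{ \|g\|_{L^2(\mathbb{R}^d)}^2 : g \ge 0 \text{ measurable}, \ \int_{\mathbb{R}^d} g(y)\,|x-y|^{s-d}\,dy \ge 1 \text{ for every } x \in E \Big\},$$ and call $E$ *$(s,2)$-uniformly fat* if there is a constant $c > 0$ such that $R_{s,2}(E \cap B(x,r)) \ge c\, r^{d-2s}$ for all $x \in E$ and all $r > 0$, where $B(x,r)$ is the open Euclidean ball. Let $\Xi \subseteq \mathbb{R}^d$ be a domain (a non-empty, open, connected set) whose complement $\mathbb{R}^d \setminus \Xi$ is $(s,2)$-uniformly fat. Then there is a constant $C > 0$ such that for every $f \in C^\infty(\mathbb{R}^d;\mathbb{C})$ with compact support contained in $\Xi$, $$\int_\Xi \frac{|f(x)|^2}{\mathrm{dist}(x,\partial \Xi)^{2s}}\,dx \;\le\; C \int_{\mathbb{R}^d}\int_{\mathbb{R}^d} \frac{|f(x)-f(y)|^2}{|x-y|^{2s+d}}\,dx\,dy .$$ Both sides are integrals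 of non-negative functions with values in $[0,\infty]$; if $\partial\Xi=\emptyset$ (that is, $\Xi = \mathbb{R}^d$), then $\mathrm{dist}(x,\partial\Xi)=\infty$ and the left-hand side is $0$. -/

import Mathlib

open MeasureTheory
open scoped ENNReal ContDiff

noncomputable section

/-- The Riesz kernel `I_s(x) = |x|^(s-d)` on `ℝ^d`, with values in `[0,∞]`
(for `s < d` its value at the origin is `∞`). -/
def rieszKernel (d : ℕ) (s : ℝ) (x : EuclideanSpace ℝ (Fin d)) : ℝ≥0∞ :=
  ‖x‖ₑ ^ (s - (d : ℝ))

/-- The convolution `(g * I_s)(x) = ∫ g(y) |x-y|^(s-d) dy ∈ [0,∞]` of a non-negative function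
with the Riesz kernel. -/
def rieszPotential (d : ℕ) (s : ℝ) (g : EuclideanSpace ℝ (Fin d) → ℝ≥0∞)
    (x : EuclideanSpace ℝ (Fin d)) : ℝ≥0∞ :=
  ∫⁻ y, g y * rieszKernel d s (x - y)

/-- The `(s,2)`-outer capacity of `E ⊆ ℝ^d`: the infimum of `‖g‖²_{L²}` over all non-negative
measurable `g` with `g * I_s ≥ 1` at every point of `E`. A `g` of infinite `L²`-norm does not
affect the infimum, so taking `g` with values in `[0,∞]` is the same as taking `0 ≤ g ∈ L²`. -/
def rieszCapacity (d : ℕ) (s : ℝ) (E : Set (EuclideanSpace ℝ (Fin d))) : ℝ≥0∞ :=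
  ⨅ (g : EuclideanSpace ℝ (Fin d) → ℝ≥0∞) (_ : AEMeasurable g volume)
    (_ : ∀ x ∈ E, 1 ≤ rieszPotential d s g x), ∫⁻ y, g y ^ 2

/-- `E ⊆ ℝ^d` is `(s,2)`-uniformly fat: the capacity of `E ∩ B(x,r)` is at least `c r^(d-2s)`
for all `x ∈ E` and `r > 0`, with some `c > 0` independent of `x` and `r`. -/
def IsUniformlyFat (d : ℕ) (s : ℝ) (E : Set (EuclideanSpace ℝ (Fin d))) : Prop :=
  ∃ c : ℝ, 0 < c ∧ ∀ x ∈ E, ∀ r : ℝ, 0 < r →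
    ENNReal.ofReal (c * r ^ ((d : ℝ) - 2 * s)) ≤ rieszCapacity d s (E ∩ Metric.ball x r)

end

/-!
A fractional Hardy inequality on a domain with uniformly fat complement `K`. The boundary of the
domain lies in `K`, so it suffices to work with `dist(·, K)`.

*Capacity and mean values.* Let `g(y)² = ∫_B |F(y) - F(z)|² / |y - z|^(2s+d) dz` on a ball `B`
of radius `2t` (`nonlocalGradient`). Telescoping the mean values of `|F|` over the balls
`B(x, t / 2^k)` and using the Cauchy–Schwarz inequality on each, the mean value of `|F|` over `B`
is at most a constant times the Riesz potential of `g` at every `x` in the concentric ball of radius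
`t` near which `F` vanishes (`laverage_ball_enorm_le_rieszPotential`). Hence a multiple of `g` is
admissible for the capacity of the zero set, and `‖g‖₂²` is exactly the energy of `F` on `B × B`.
With uniform fatness this is a capacitary Poincaré inequality (`setLIntegral_ball_enorm_sq_le`).

*Weighted inequality.* The local inequality at the scale `dist(x, K)` cannot be summed directly, as
the balls reaching `K` overlap infinitely often. Integrated against `dist(x, K)^(-2s-β-d) dx` with
`β > 0` it does converge, with a constant `O(1 / β)`
(`lintegral_infDist_rpow_mul_enorm_sq_le`):
`∫ |F|² dist(y, K)^(-2s-β) ≤ (C / β) ∫∫ |F(y) - F(z)|² / |y - z|^(2s+d) M(y, z)^(-β)`,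
where `M(y, z) = max(dist(y, K), dist(z, K))`.

*Absorption.* Put `F = dist(·, K)^(β/2) f`. The weights cancel, up to the increments of
`dist(·, K)^(β/2)`, whose squares are of size `β² log²(1 + |y - z| / dist(y, K)) M^β`, where `y`
is the point nearer to `K`. For `s < 1` the resulting error is `O(β) ∫ |f|² dist(y, K)^(-2s)`,
which is finite and is absorbed for small `β` (`hardy_of_lt_one`).

*Large exponents.* For `s ≥ 1` a scaling argument shows that every energy is `0` or `∞`
(`lintegral_gagliardoDensity_eq_zero_of_one_le`), so that the inequality holds trivially.
-/

section Hardy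

variable {d : ℕ} {s : ℝ}

local notation "𝔼" => EuclideanSpace ℝ (Fin d)

/-! ### Lebesgue measure and radial integrals -/

theorem lintegral_eq_lintegral_comp_smul (h : 𝔼 → ℝ≥0∞) {a : ℝ} (ha : 0 < a) :
    ∫⁻ w, h w = ENNReal.ofReal (a ^ d) * ∫⁻ w, h (a • w) := by
  have key := lintegral_map_equiv (μ := (volume : Measure 𝔼)) h
    (Homeomorph.smulOfNeZero a ha.ne').toMeasurableEquiv
  have hmap : Measure.map (Homeomorph.smulOfNeZero a ha.ne').toMeasurableEquiv
      (volume : Measure 𝔼) = ENNReal.ofReal ((a ^ d)⁻¹) • volume := by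
    have := Measure.map_addHaar_smul (volume : Measure 𝔼) ha.ne'
    rw [finrank_euclideanSpace_fin, abs_of_pos (by positivity)] at this
    exact this
  rw [hmap, lintegral_smul_measure, smul_eq_mul] at key
  have key' : ENNReal.ofReal ((a ^ d)⁻¹) * ∫⁻ w, h w = ∫⁻ w, h (a • w) := key
  rw [← key', ← mul_assoc, ← ENNReal.ofReal_mul (by positivity),
    mul_inv_cancel₀ (by positivity), ENNReal.ofReal_one, one_mul]

theorem volume_ball_eq_ofReal (x : 𝔼) {r : ℝ} (hr : 0 < r) :
    volume (Metric.ball x r) =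
      ENNReal.ofReal (r ^ d * (volume : Measure 𝔼).real (Metric.ball 0 1)) := by
  rw [ENNReal.ofReal_mul (by positivity), ofReal_measureReal measure_ball_lt_top.ne]
  simpa using Measure.addHaar_ball_of_pos (volume : Measure 𝔼) x hr

theorem volume_real_ball_pos : 0 < (volume : Measure 𝔼).real (Metric.ball 0 1) :=
  ENNReal.toReal_pos (Metric.measure_ball_pos _ _ one_pos).ne' measure_ball_lt_top.ne

theorem isProbabilityMeasure_restrict_ball (p : 𝔼) {R : ℝ} (hR : 0 < R) : IsProbabilityMeasure
    ((volume.restrict (Metric.ball p R) Set.univ)⁻¹ • volume.restrict (Metric.ball p R)) := by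
  have : NeZero (volume.restrict (Metric.ball p R)) :=
    ⟨by simpa [Measure.restrict_eq_zero] using (Metric.measure_ball_pos volume p hR).ne'⟩
  have : IsFiniteMeasure (volume.restrict (Metric.ball p R)) :=
    ⟨by simpa using measure_ball_lt_top⟩
  infer_instance

theorem ennreal_add_sq_le_two_mul (a b : ℝ≥0∞) : (a + b) ^ 2 ≤ 2 * (a ^ 2 + b ^ 2) := by
  have := ENNReal.rpow_add_le_mul_rpow_add_rpow a b one_le_two
  norm_num at this
  exact_mod_cast this

/-- The constant is uniform in `β`, up to the factor `1 / β`: the integral over the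
complement of the unit ball is a multiple of `∫₁^∞ t^(-1-β) dt`. -/
theorem lintegral_max_one_norm_rpow_le (hd : 1 ≤ d) :
    ∃ C : ℝ, 0 < C ∧ ∀ β : ℝ, 0 < β → β ≤ 1 →
      ∫⁻ w : 𝔼, ENNReal.ofReal (max 1 ‖w‖ ^ (-((d : ℝ) + β))) ≤ ENNReal.ofReal (C / β) := by
  have : Nontrivial 𝔼 := by
    have : Nonempty (Fin d) := ⟨⟨0, hd⟩⟩
    infer_instance
  set V : ℝ := (volume : Measure 𝔼).real (Metric.ball 0 1) with hV
  have hV0 : 0 ≤ V := measureReal_nonneg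
  refine ⟨2 * d * V + 1, by positivity, fun β hβ hβ1 => ?_⟩
  have hdm : ∀ y : ℝ, 0 < y → y ^ (d - 1) = y ^ ((d : ℝ) - 1) := fun y hy => by
    rw [← Real.rpow_natCast, Nat.cast_sub hd, Nat.cast_one]
  have h1 : IntegrableOn (fun y : ℝ => y ^ (d - 1) • max 1 y ^ (-((d : ℝ) + β))) (Set.Ioc 0 1) := by
    refine (ContinuousOn.integrableOn_Icc ?_).mono_set Set.Ioc_subset_Icc_self
    refine ContinuousOn.smul (continuous_pow _).continuousOn ?_
    refine ContinuousOn.rpow_const ?_ fun y _ => Or.inl (by positivity)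
    exact (continuous_const.max continuous_id).continuousOn
  have heq : Set.EqOn (fun y : ℝ => y ^ (d - 1) • max 1 y ^ (-((d : ℝ) + β)))
      (fun y => y ^ (-1 - β)) (Set.Ioi 1) := fun y (hy : 1 < y) => by
    have hy0 : 0 < y := by linarith
    simp only [smul_eq_mul]
    rw [max_eq_right hy.le, hdm y hy0, ← Real.rpow_add hy0]
    ring_nf
  have h2 : IntegrableOn (fun y : ℝ => y ^ (d - 1) • max 1 y ^ (-((d : ℝ) + β))) (Set.Ioi 1) :=
    (integrableOn_Ioi_rpow_of_lt (by linarith) one_pos).congr_fun heq.symm measurableSet_Ioi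
  have h12 := h1.union h2
  rw [Set.Ioc_union_Ioi_eq_Ioi zero_le_one] at h12
  have hint : Integrable (fun w : 𝔼 => max 1 ‖w‖ ^ (-((d : ℝ) + β))) := by
    rw [integrable_fun_norm_addHaar (volume : Measure 𝔼)
      (f := fun y => max 1 y ^ (-((d : ℝ) + β))), finrank_euclideanSpace_fin]
    exact h12
  rw [← ofReal_integral_eq_lintegral_ofReal hint (ae_of_all _ fun w => by positivity)]
  apply ENNReal.ofReal_le_ofReal
  rw [integral_fun_norm_addHaar (volume : Measure 𝔼) (fun y => max 1 y ^ (-((d : ℝ) + β))),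
    finrank_euclideanSpace_fin, ← Set.Ioc_union_Ioi_eq_Ioi zero_le_one,
    setIntegral_union (Set.Ioc_disjoint_Ioi le_rfl) measurableSet_Ioi h1 h2,
    setIntegral_congr_fun measurableSet_Ioi heq, integral_Ioi_rpow_of_lt (by linarith) one_pos]
  have h3 : ∫ y in Set.Ioc (0 : ℝ) 1, y ^ (d - 1) • max 1 y ^ (-((d : ℝ) + β)) ≤ 1 := by
    calc _ ≤ ∫ y in Set.Ioc (0 : ℝ) 1, (1 : ℝ) := by
          refine setIntegral_mono_on h1 (by simp) measurableSet_Ioc fun y hy => ?_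
          rw [max_eq_left hy.2]
          simpa using pow_le_one₀ hy.1.le hy.2
      _ = 1 := by simp
  have h4 : -(1 : ℝ) ^ (-1 - β + 1) / (-1 - β + 1) = 1 / β := by
    rw [Real.one_rpow, show -1 - β + 1 = -β by ring, neg_div_neg_eq]
  have h5 : 1 ≤ 1 / β := by rw [le_div_iff₀ hβ]; linarith
  rw [h4, nsmul_eq_mul, smul_eq_mul, ← hV]
  calc (d : ℝ) * (V * ((∫ y in Set.Ioc (0 : ℝ) 1, y ^ (d - 1) • max 1 y ^ (-((d : ℝ) + β))) + 1 / β))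
      ≤ d * (V * (1 / β + 1 / β)) := by gcongr; linarith
    _ ≤ (2 * d * V + 1) / β := by
        rw [show (d : ℝ) * (V * (1 / β + 1 / β)) = (2 * d * V) / β by ring]
        gcongr; linarith

theorem lintegral_log_sq_mul_norm_rpow_lt_top (hd : 1 ≤ d) {s : ℝ} (hs : 0 < s) (hs1 : s < 1) :
    ∫⁻ w : 𝔼, ENNReal.ofReal (Real.log (1 + ‖w‖) ^ 2 * ‖w‖ ^ (-((d : ℝ) + 2 * s))) < ⊤ := by
  have : Nontrivial 𝔼 := by
    have : Nonempty (Fin d) := ⟨⟨0, hd⟩⟩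
    infer_instance
  have hdm : ∀ y : ℝ, 0 < y → y ^ (d - 1) = y ^ ((d : ℝ) - 1) := fun y hy => by
    rw [← Real.rpow_natCast, Nat.cast_sub hd, Nat.cast_one]
  set φ : ℝ → ℝ := fun y => Real.log (1 + y) ^ 2 * y ^ (-((d : ℝ) + 2 * s)) with hφ
  have hmeas : Measurable fun y : ℝ => y ^ (d - 1) • φ y := by
    simp only [hφ]; fun_prop
  have h1 : IntegrableOn (fun y : ℝ => y ^ (d - 1) • φ y) (Set.Ioc 0 1) := by
    have hI : IntegrableOn (fun y : ℝ => y ^ (1 - 2 * s)) (Set.Ioc 0 1) := by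
      have := intervalIntegral.intervalIntegrable_rpow' (a := 0) (b := 1) (r := 1 - 2 * s)
        (by linarith)
      rwa [intervalIntegrable_iff_integrableOn_Ioc_of_le zero_le_one] at this
    refine hI.mono' hmeas.aestronglyMeasurable ?_
    refine (ae_restrict_iff' measurableSet_Ioc).2 (ae_of_all _ fun y hy => ?_)
    have hy0 := hy.1
    have hlog0 : 0 ≤ Real.log (1 + y) := Real.log_nonneg (by linarith)
    have hlog : Real.log (1 + y) ≤ y := by
      have := Real.log_le_sub_one_of_pos (show 0 < 1 + y by linarith); linarith
    rw [Real.norm_of_nonneg (by simp only [hφ, smul_eq_mul]; positivity)]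
    simp only [hφ, smul_eq_mul]
    calc y ^ (d - 1) * (Real.log (1 + y) ^ 2 * y ^ (-((d : ℝ) + 2 * s)))
        ≤ y ^ (d - 1) * (y ^ 2 * y ^ (-((d : ℝ) + 2 * s))) := by gcongr
      _ = y ^ (1 - 2 * s) := by
        rw [hdm y hy0, ← Real.rpow_natCast y 2, ← Real.rpow_add hy0, ← Real.rpow_add hy0]
        congr 1; push_cast; ring
  have h2 : IntegrableOn (fun y : ℝ => y ^ (d - 1) • φ y) (Set.Ioi 1) := by
    have hI : IntegrableOn (fun y : ℝ => (2 ^ (s / 2) / (s / 2)) ^ 2 * y ^ (-1 - s)) (Set.Ioi 1) :=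
      (integrableOn_Ioi_rpow_of_lt (by linarith) one_pos).const_mul _
    refine hI.mono' hmeas.aestronglyMeasurable ?_
    refine (ae_restrict_iff' measurableSet_Ioi).2 (ae_of_all _ fun y (hy : 1 < y) => ?_)
    have hy0 : 0 < y := by linarith
    have hlog0 : 0 ≤ Real.log (1 + y) := Real.log_nonneg (by linarith)
    have hlog : Real.log (1 + y) ≤ 2 ^ (s / 2) / (s / 2) * y ^ (s / 2) := by
      calc Real.log (1 + y) ≤ (1 + y) ^ (s / 2) / (s / 2) :=
            Real.log_le_rpow_div (by linarith) (by linarith)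
        _ ≤ (2 * y) ^ (s / 2) / (s / 2) := by gcongr; linarith
        _ = _ := by rw [Real.mul_rpow zero_le_two hy0.le]; ring
    rw [Real.norm_of_nonneg (by simp only [hφ, smul_eq_mul]; positivity)]
    simp only [hφ, smul_eq_mul]
    calc y ^ (d - 1) * (Real.log (1 + y) ^ 2 * y ^ (-((d : ℝ) + 2 * s)))
        ≤ y ^ (d - 1) * ((2 ^ (s / 2) / (s / 2) * y ^ (s / 2)) ^ 2 *
            y ^ (-((d : ℝ) + 2 * s))) := by gcongr
      _ = (2 ^ (s / 2) / (s / 2)) ^ 2 * (y ^ (d - 1) * (y ^ (s / 2)) ^ 2 *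
            y ^ (-((d : ℝ) + 2 * s))) := by ring
      _ = (2 ^ (s / 2) / (s / 2)) ^ 2 * y ^ (-1 - s) := by
        rw [hdm y hy0, ← Real.rpow_natCast (y ^ (s / 2)) 2, ← Real.rpow_mul hy0.le,
          ← Real.rpow_add hy0, ← Real.rpow_add hy0]
        congr 2; push_cast; ring
  have h12 := h1.union h2
  rw [Set.Ioc_union_Ioi_eq_Ioi zero_le_one] at h12
  have hint : Integrable (fun w : 𝔼 => φ ‖w‖) := by
    rw [integrable_fun_norm_addHaar (volume : Measure 𝔼) (f := φ), finrank_euclideanSpace_fin]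
    exact h12
  exact hint.lintegral_lt_top

/-! ### The Gagliardo energy and the nonlocal gradient -/

/-- The integrand `|F(y) - F(z)|² / |y - z|^(2s+d)` of the Gagliardo energy. On the diagonal its
value is `0 / 0 = 0`. -/
noncomputable def gagliardoDensity (s : ℝ) (F : 𝔼 → ℂ) (y z : 𝔼) : ℝ≥0∞ :=
  ‖F y - F z‖ₑ ^ 2 / ‖y - z‖ₑ ^ (2 * s + (d : ℝ))

/-- The nonlocal gradient `y ↦ (∫_B |F(y) - F(z)|² / |y - z|^(2s+d) dz)^(1/2)` of `F` relative
to `B`, extended by `0` outside `B`. Its squared `L²`-norm is the Gagliardo energy of `F`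
on `B × B`. -/
noncomputable def nonlocalGradient (s : ℝ) (F : 𝔼 → ℂ) (B : Set 𝔼) : 𝔼 → ℝ≥0∞ :=
  B.indicator fun y => (∫⁻ z in B, gagliardoDensity s F y z) ^ (1 / 2 : ℝ)

theorem gagliardoDensity_comm (F : 𝔼 → ℂ) (y z : 𝔼) :
    gagliardoDensity s F y z = gagliardoDensity s F z y := by
  unfold gagliardoDensity
  rw [enorm_sub_rev (F y), enorm_sub_rev y]

theorem measurable_gagliardoDensity {F : 𝔼 → ℂ} (hF : Measurable F) :
    Measurable fun p : 𝔼 × 𝔼 => gagliardoDensity s F p.1 p.2 := by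
  unfold gagliardoDensity
  fun_prop

theorem measurable_nonlocalGradient {F : 𝔼 → ℂ} (hF : Measurable F) {B : Set 𝔼}
    (hB : MeasurableSet B) : Measurable (nonlocalGradient s F B) := by
  refine Measurable.indicator ?_ hB
  exact ((measurable_gagliardoDensity hF).lintegral_prod_right' (ν := volume.restrict B)).pow_const _

theorem lintegral_nonlocalGradient_sq (F : 𝔼 → ℂ) {B : Set 𝔼} (hB : MeasurableSet B) :
    ∫⁻ y, nonlocalGradient s F B y ^ 2 =
      ∫⁻ y in B, ∫⁻ z in B, gagliardoDensity s F y z := by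
  rw [← lintegral_indicator hB]
  congr 1
  ext y
  by_cases hy : y ∈ B
  · simp only [nonlocalGradient, Set.indicator_of_mem hy]
    rw [← ENNReal.rpow_natCast, ← ENNReal.rpow_mul]
    simp
  · simp [nonlocalGradient, hy]

theorem enorm_sub_sq_eq_gagliardoDensity_mul (hsd : 0 < 2 * s + (d : ℝ)) (F : 𝔼 → ℂ) (y z : 𝔼) :
    ‖F y - F z‖ₑ ^ 2 = gagliardoDensity s F y z * ‖y - z‖ₑ ^ (2 * s + (d : ℝ)) := by
  rcases eq_or_ne y z with rfl | h
  · simp [gagliardoDensity]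
  · have h0 : ‖y - z‖ₑ ≠ 0 := by simpa [sub_eq_zero] using h
    refine (ENNReal.div_mul_cancel ?_ ?_).symm
    · exact (ENNReal.rpow_pos (pos_iff_ne_zero.2 h0) enorm_ne_top).ne'
    · exact ENNReal.rpow_ne_top_of_nonneg hsd.le enorm_ne_top

/-! ### Mean values over balls -/

/-- The mean oscillation of `F` around `F y` at scale `R` is at most `R ^ s` times the nonlocal
gradient, since `|y - z| < 2 * R` on the ball. -/
theorem laverage_ball_enorm_sub_le (hs : 0 < s) :
    ∃ C : ℝ, 0 < C ∧ ∀ F : 𝔼 → ℂ, Measurable F → ∀ (p : 𝔼) (R : ℝ) (B : Set 𝔼),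
      Metric.ball p R ⊆ B → ∀ y ∈ Metric.ball p R,
        ⨍⁻ z in Metric.ball p R, ‖F y - F z‖ₑ ∂volume ≤
          ENNReal.ofReal (C * R ^ s) * nonlocalGradient s F B y := by
  set v : ℝ := (volume : Measure 𝔼).real (Metric.ball 0 1) with hv
  have hv0 : 0 < v := volume_real_ball_pos
  refine ⟨(v⁻¹ * 2 ^ (2 * s + (d : ℝ))) ^ (1 / 2 : ℝ), by positivity,
    fun F hF p R B hB y hy => ?_⟩
  have hR : 0 < R := Metric.nonempty_ball.1 ⟨y, hy⟩
  have hsd : 0 < 2 * s + (d : ℝ) := by positivity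
  have hvol := volume_ball_eq_ofReal p hR
  have hprob := isProbabilityMeasure_restrict_ball p hR
  have hm : Measurable fun z => ‖F y - F z‖ₑ := by fun_prop
  -- The Cauchy–Schwarz inequality for the normalised measure.
  have hCS : ⨍⁻ z in Metric.ball p R, ‖F y - F z‖ₑ ∂volume ≤
      (⨍⁻ z in Metric.ball p R, ‖F y - F z‖ₑ ^ 2 ∂volume) ^ (1 / 2 : ℝ) := by
    have := ENNReal.lintegral_mul_le_Lp_mul_Lq
      ((volume.restrict (Metric.ball p R) Set.univ)⁻¹ • volume.restrict (Metric.ball p R))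
      (Real.HolderConjugate.two_two) (f := fun z => ‖F y - F z‖ₑ) (g := fun _ => 1)
      hm.aemeasurable aemeasurable_const
    simpa [laverage, ENNReal.inv_mul_cancel (Metric.measure_ball_pos volume p hR).ne'
      measure_ball_lt_top.ne] using this
  refine hCS.trans ?_
  have h2 : ⨍⁻ z in Metric.ball p R, ‖F y - F z‖ₑ ^ 2 ∂volume ≤
      ENNReal.ofReal (v⁻¹ * 2 ^ (2 * s + (d : ℝ)) * R ^ (2 * s)) *
        ∫⁻ z in B, gagliardoDensity s F y z := by
    rw [setLAverage_eq, ENNReal.div_eq_inv_mul, hvol, ← ENNReal.ofReal_inv_of_pos (by positivity)]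
    calc ENNReal.ofReal (R ^ d * v)⁻¹ * ∫⁻ z in Metric.ball p R, ‖F y - F z‖ₑ ^ 2
        ≤ ENNReal.ofReal (R ^ d * v)⁻¹ * ∫⁻ z in Metric.ball p R,
            ENNReal.ofReal ((2 * R) ^ (2 * s + (d : ℝ))) * gagliardoDensity s F y z := by
          refine mul_le_mul' le_rfl (setLIntegral_mono' measurableSet_ball fun z hz => ?_)
          rw [enorm_sub_sq_eq_gagliardoDensity_mul hsd, mul_comm]
          gcongr
          rw [← ENNReal.ofReal_rpow_of_pos (by positivity), ← ofReal_norm]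
          gcongr
          rw [← dist_eq_norm]
          rw [Metric.mem_ball] at hy hz
          linarith [dist_triangle_right y z p]
      _ = ENNReal.ofReal ((R ^ d * v)⁻¹ * (2 * R) ^ (2 * s + (d : ℝ))) *
            ∫⁻ z in Metric.ball p R, gagliardoDensity s F y z := by
          rw [lintegral_const_mul', ← mul_assoc, ← ENNReal.ofReal_mul (by positivity)]
          exact ENNReal.ofReal_ne_top
      _ ≤ _ := by
          gcongr ?_ * ?_
          · refine ENNReal.ofReal_le_ofReal (le_of_eq ?_)
            rw [Real.mul_rpow zero_le_two hR.le, Real.rpow_add hR, Real.rpow_natCast]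
            field_simp
          · exact lintegral_mono_set hB
  rw [nonlocalGradient, Set.indicator_of_mem (hB hy)]
  calc _ ≤ (ENNReal.ofReal (v⁻¹ * 2 ^ (2 * s + (d : ℝ)) * R ^ (2 * s)) *
        ∫⁻ z in B, gagliardoDensity s F y z) ^ (1 / 2 : ℝ) := by gcongr
    _ = _ := by
      rw [ENNReal.mul_rpow_of_nonneg _ _ (by norm_num),
        ENNReal.ofReal_rpow_of_pos (by positivity), Real.mul_rpow (by positivity) (by positivity),
        ← Real.rpow_mul hR.le]
      congr 4
      ring

/-- One step of the telescoping: the mean value over a ball exceeds the mean value over a ball of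
half the radius contained in it by at most a truncated potential of the nonlocal gradient. -/
theorem laverage_ball_enorm_le (hs : 0 < s) :
    ∃ C : ℝ, 0 < C ∧ ∀ F : 𝔼 → ℂ, Measurable F → ∀ (p x : 𝔼) (ρ : ℝ) (B : Set 𝔼), 0 < ρ →
      Metric.ball x ρ ⊆ Metric.ball p (2 * ρ) → Metric.ball p (2 * ρ) ⊆ B →
        ⨍⁻ z in Metric.ball p (2 * ρ), ‖F z‖ₑ ∂volume ≤ (⨍⁻ y in Metric.ball x ρ, ‖F y‖ₑ ∂volume) +
          ENNReal.ofReal (C * ρ ^ (s - (d : ℝ))) *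
            ∫⁻ y in Metric.ball x ρ, nonlocalGradient s F B y := by
  obtain ⟨C, hC, hA⟩ := laverage_ball_enorm_sub_le (d := d) hs
  set v : ℝ := (volume : Measure 𝔼).real (Metric.ball 0 1) with hv
  have hv0 : 0 < v := volume_real_ball_pos
  refine ⟨v⁻¹ * (C * 2 ^ s), by positivity, fun F hF p x ρ B hρ hxp hpB => ?_⟩
  have hp1 := isProbabilityMeasure_restrict_ball p (R := 2 * ρ) (by positivity)
  have hp2 := isProbabilityMeasure_restrict_ball x hρ
  have hpt : ∀ y, ⨍⁻ z in Metric.ball p (2 * ρ), ‖F z‖ₑ ∂volume ≤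
      ‖F y‖ₑ + ⨍⁻ z in Metric.ball p (2 * ρ), ‖F y - F z‖ₑ ∂volume := fun y => by
    calc ⨍⁻ z in Metric.ball p (2 * ρ), ‖F z‖ₑ ∂volume
        ≤ ⨍⁻ z in Metric.ball p (2 * ρ), (‖F y‖ₑ + ‖F y - F z‖ₑ) ∂volume := by
          refine lintegral_mono fun z => ?_
          simpa using enorm_sub_le (a := F y) (b := F y - F z)
      _ = _ := by
          rw [laverage, lintegral_add_left measurable_const, lintegral_const, measure_univ,
            mul_one]
          rfl
  calc ⨍⁻ z in Metric.ball p (2 * ρ), ‖F z‖ₑ ∂volume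
      = ⨍⁻ _ in Metric.ball x ρ, (⨍⁻ z in Metric.ball p (2 * ρ), ‖F z‖ₑ ∂volume) ∂volume := by
        exact (setLAverage_const (Metric.measure_ball_pos _ _ hρ).ne' measure_ball_lt_top.ne _).symm
    _ ≤ ⨍⁻ y in Metric.ball x ρ, (‖F y‖ₑ + ⨍⁻ z in Metric.ball p (2 * ρ), ‖F y - F z‖ₑ ∂volume) ∂volume :=
        lintegral_mono hpt
    _ = (⨍⁻ y in Metric.ball x ρ, ‖F y‖ₑ ∂volume) +
          ⨍⁻ y in Metric.ball x ρ, (⨍⁻ z in Metric.ball p (2 * ρ), ‖F y - F z‖ₑ ∂volume) ∂volume := by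
        rw [laverage, lintegral_add_left hF.enorm]; rfl
    _ ≤ _ := by
        refine add_le_add le_rfl ?_
        rw [setLAverage_eq _ _ (Metric.ball x ρ), ENNReal.div_eq_inv_mul, volume_ball_eq_ofReal x hρ,
          ← ENNReal.ofReal_inv_of_pos (by positivity)]
        calc _ ≤ ENNReal.ofReal (ρ ^ d * v)⁻¹ * ∫⁻ y in Metric.ball x ρ,
              ENNReal.ofReal (C * (2 * ρ) ^ s) * nonlocalGradient s F B y := by
              exact mul_le_mul' le_rfl (setLIntegral_mono' measurableSet_ball fun y hy =>
                hA F hF p (2 * ρ) B hpB y (hxp hy))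
          _ = _ := by
              rw [lintegral_const_mul' _ _ ENNReal.ofReal_ne_top, ← mul_assoc,
                ← ENNReal.ofReal_mul (by positivity)]
              congr 2
              rw [Real.mul_rpow zero_le_two hρ.le, Real.rpow_sub hρ, Real.rpow_natCast]
              field_simp

/-! ### Potential estimate and the capacitary Poincaré inequality -/

theorem sum_range_dyadic_rpow_le {σ : ℝ} (hσ : 0 < σ) {t : ℝ} (ht : 0 < t) (N : ℕ) :
    ∑ k ∈ Finset.range (N + 1), (t / 2 ^ k) ^ (-σ) ≤
      2 ^ σ / (2 ^ σ - 1) * (t / 2 ^ N) ^ (-σ) := by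
  have hq : 1 < (2 : ℝ) ^ σ := Real.one_lt_rpow one_lt_two hσ
  have hq1 : 0 < (2 : ℝ) ^ σ - 1 := by linarith
  induction N with
  | zero =>
    have : 1 ≤ (2 : ℝ) ^ σ / (2 ^ σ - 1) := by rw [le_div_iff₀ hq1]; linarith
    simpa using le_mul_of_one_le_left (by positivity : 0 ≤ t ^ (-σ)) this
  | succ N ih =>
    rw [Finset.sum_range_succ]
    have hstep : (t / 2 ^ (N + 1)) ^ (-σ) = 2 ^ σ * (t / 2 ^ N) ^ (-σ) := by
      rw [show t / 2 ^ (N + 1) = 2⁻¹ * (t / 2 ^ N) by rw [pow_succ]; field_simp,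
        Real.mul_rpow (by norm_num) (by positivity), Real.inv_rpow zero_le_two,
        Real.rpow_neg zero_le_two, inv_inv]
    rw [hstep]
    refine (add_le_add_left ih _).trans (le_of_eq ?_)
    field_simp
    ring

/-- A geometric sum: only the scales `t / 2 ^ k > |x - y|` contribute, and the smallest of
them dominates. -/
theorem sum_range_dyadic_indicator_le (hsd : s < (d : ℝ)) {t : ℝ} (ht : 0 < t) (x y : 𝔼) (N : ℕ) :
    ∑ k ∈ Finset.range N, (Metric.ball x (t / 2 ^ k)).indicator
        (fun _ => ENNReal.ofReal ((t / 2 ^ k) ^ (s - (d : ℝ)))) y ≤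
      ENNReal.ofReal (2 ^ ((d : ℝ) - s) / (2 ^ ((d : ℝ) - s) - 1)) * rieszKernel d s (x - y) := by
  have hσ : 0 < (d : ℝ) - s := by linarith
  have hq : 1 < (2 : ℝ) ^ ((d : ℝ) - s) := Real.one_lt_rpow one_lt_two hσ
  have hq1 : 0 < (2 : ℝ) ^ ((d : ℝ) - s) - 1 := by linarith
  induction N with
  | zero => simp
  | succ N ih =>
    by_cases hy : y ∈ Metric.ball x (t / 2 ^ N)
    · calc _ ≤ ∑ k ∈ Finset.range (N + 1), ENNReal.ofReal ((t / 2 ^ k) ^ (-((d : ℝ) - s))) := by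
            rw [neg_sub]
            exact Finset.sum_le_sum fun k _ => Set.indicator_le_self _ _ _
        _ = ENNReal.ofReal (∑ k ∈ Finset.range (N + 1), (t / 2 ^ k) ^ (-((d : ℝ) - s))) := by
            rw [ENNReal.ofReal_sum_of_nonneg fun k _ => by positivity]
        _ ≤ ENNReal.ofReal (2 ^ ((d : ℝ) - s) / (2 ^ ((d : ℝ) - s) - 1) *
              (t / 2 ^ N) ^ (-((d : ℝ) - s))) :=
            ENNReal.ofReal_le_ofReal (sum_range_dyadic_rpow_le hσ ht N)
        _ ≤ _ := by
            rw [ENNReal.ofReal_mul (by positivity), rieszKernel,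
              ← ENNReal.ofReal_rpow_of_pos (by positivity), neg_sub]
            refine mul_le_mul' le_rfl ?_
            rw [← neg_sub (d : ℝ) s, ENNReal.rpow_neg, ENNReal.rpow_neg, ENNReal.inv_le_inv]
            refine ENNReal.rpow_le_rpow ?_ hσ.le
            rw [← ofReal_norm, ← dist_eq_norm, dist_comm]
            exact ENNReal.ofReal_le_ofReal (Metric.mem_ball.1 hy).le
    · rw [Finset.sum_range_succ, Set.indicator_of_notMem hy, add_zero]
      exact ih

theorem laverage_ball_enorm_le_dyadic_sum (hs : 0 < s) :
    ∃ C : ℝ, 0 < C ∧ ∀ F : 𝔼 → ℂ, Measurable F → ∀ (p x : 𝔼) (t : ℝ), x ∈ Metric.ball p t →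
      ∀ N : ℕ, ⨍⁻ z in Metric.ball p (2 * t), ‖F z‖ₑ ∂volume ≤
        (⨍⁻ y in Metric.ball x (t / 2 ^ N), ‖F y‖ₑ ∂volume) +
          ∑ k ∈ Finset.range (N + 1), ENNReal.ofReal (C * (t / 2 ^ k) ^ (s - (d : ℝ))) *
            ∫⁻ y in Metric.ball x (t / 2 ^ k),
              nonlocalGradient s F (Metric.ball p (2 * t)) y := by
  obtain ⟨C, hC, hB⟩ := laverage_ball_enorm_le (d := d) hs
  refine ⟨C, hC, fun F hF p x t hx N => ?_⟩
  have ht : 0 < t := Metric.nonempty_ball.1 ⟨x, hx⟩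
  have hsub : Metric.ball x t ⊆ Metric.ball p (2 * t) :=
    Metric.ball_subset_ball' (by rw [Metric.mem_ball] at hx; linarith)
  induction N with
  | zero => simpa using hB F hF p x t _ ht hsub subset_rfl
  | succ N ih =>
    refine ih.trans ?_
    have h2 : 2 * (t / 2 ^ (N + 1)) = t / 2 ^ N := by rw [pow_succ]; field_simp
    have hNt : t / 2 ^ N ≤ t := div_le_self ht.le (one_le_pow₀ one_le_two)
    have hpos : 0 < t / 2 ^ (N + 1) := by positivity
    have := hB F hF x x (t / 2 ^ (N + 1)) (Metric.ball p (2 * t)) hpos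
      (Metric.ball_subset_ball (by linarith))
      (by rw [h2]; exact (Metric.ball_subset_ball hNt).trans hsub)
    rw [h2] at this
    rw [Finset.sum_range_succ _ (N + 1)]
    refine (add_le_add_left this _).trans (le_of_eq ?_)
    ring

/-- Pointwise bound by a Riesz potential: if `F` vanishes near `x`, its mean value over a ball
around `x` is controlled by the Riesz potential at `x` of the nonlocal gradient. It is obtained by
telescoping the mean values over the balls of radius `t / 2 ^ k` around `x`. -/
theorem laverage_ball_enorm_le_rieszPotential (hs : 0 < s) (hsd : s < (d : ℝ)) :
    ∃ C : ℝ, 0 < C ∧ ∀ F : 𝔼 → ℂ, Measurable F → ∀ (p x : 𝔼) (t : ℝ), x ∈ Metric.ball p t →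
      (∀ᶠ y in nhds x, F y = 0) → ⨍⁻ z in Metric.ball p (2 * t), ‖F z‖ₑ ∂volume ≤
        ENNReal.ofReal C *
          rieszPotential d s (nonlocalGradient s F (Metric.ball p (2 * t))) x := by
  obtain ⟨C, hC, hB⟩ := laverage_ball_enorm_le_dyadic_sum (d := d) hs
  have hq : 1 < (2 : ℝ) ^ ((d : ℝ) - s) := Real.one_lt_rpow one_lt_two (by linarith)
  have hq1 : 0 < (2 : ℝ) ^ ((d : ℝ) - s) - 1 := by linarith
  refine ⟨C * (2 ^ ((d : ℝ) - s) / (2 ^ ((d : ℝ) - s) - 1)), by positivity,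
    fun F hF p x t hx hFx => ?_⟩
  have ht : 0 < t := Metric.nonempty_ball.1 ⟨x, hx⟩
  obtain ⟨ε, hε, hFε⟩ := Metric.eventually_nhds_iff_ball.1 hFx
  obtain ⟨N, hN⟩ : ∃ N : ℕ, t / 2 ^ N ≤ ε := by
    obtain ⟨N, hN⟩ := pow_unbounded_of_one_lt (t / ε) one_lt_two
    refine ⟨N, ?_⟩
    rw [div_le_iff₀ (by positivity), mul_comm]
    rw [div_lt_iff₀ hε] at hN
    exact hN.le
  have h0 : ⨍⁻ y in Metric.ball x (t / 2 ^ N), ‖F y‖ₑ ∂volume = 0 := by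
    rw [setLAverage_eq, setLIntegral_congr_fun (g := fun _ => 0) measurableSet_ball]
    · simp
    · intro y hy
      simp [hFε y (Metric.ball_subset_ball hN hy)]
  set g := nonlocalGradient s F (Metric.ball p (2 * t)) with hg
  have hgm : Measurable g := measurable_nonlocalGradient hF measurableSet_ball
  refine (hB F hF p x t hx N).trans ?_
  rw [h0, zero_add, ENNReal.ofReal_mul hC.le, mul_assoc]
  calc ∑ k ∈ Finset.range (N + 1), ENNReal.ofReal (C * (t / 2 ^ k) ^ (s - (d : ℝ))) *
        ∫⁻ y in Metric.ball x (t / 2 ^ k), g y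
      = ENNReal.ofReal C * ∑ k ∈ Finset.range (N + 1), ∫⁻ y, g y *
          (Metric.ball x (t / 2 ^ k)).indicator
            (fun _ => ENNReal.ofReal ((t / 2 ^ k) ^ (s - (d : ℝ)))) y := by
        rw [Finset.mul_sum]
        refine Finset.sum_congr rfl fun k _ => ?_
        rw [ENNReal.ofReal_mul hC.le, mul_assoc,
          ← lintegral_const_mul' _ _ ENNReal.ofReal_ne_top, ← lintegral_indicator measurableSet_ball]
        congr 2
        ext y
        by_cases hy : y ∈ Metric.ball x (t / 2 ^ k)
        · simp only [Set.indicator_of_mem hy, mul_comm]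
        · simp only [Set.indicator_of_notMem hy, mul_zero]
    _ = ENNReal.ofReal C * ∫⁻ y, g y * ∑ k ∈ Finset.range (N + 1),
          (Metric.ball x (t / 2 ^ k)).indicator
            (fun _ => ENNReal.ofReal ((t / 2 ^ k) ^ (s - (d : ℝ)))) y := by
        congr 1
        simp_rw [Finset.mul_sum]
        rw [lintegral_finsetSum]
        exact fun k _ => hgm.mul (measurable_const.indicator measurableSet_ball)
    _ ≤ ENNReal.ofReal C * ∫⁻ y, g y *
          (ENNReal.ofReal (2 ^ ((d : ℝ) - s) / (2 ^ ((d : ℝ) - s) - 1)) *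
            rieszKernel d s (x - y)) := by
        gcongr with y
        exact sum_range_dyadic_indicator_le hsd ht x y (N + 1)
    _ = _ := by
        congr 1
        rw [rieszPotential, ← lintegral_const_mul' _ _ ENNReal.ofReal_ne_top]
        exact lintegral_congr fun y => mul_left_comm _ _ _

/-- The capacity of the zero set of `F` bounds the mean value of `F` by its energy: a multiple
of the nonlocal gradient is admissible for the capacity. -/
theorem laverage_sq_mul_rieszCapacity_le (hs : 0 < s) (hsd : s < (d : ℝ)) :
    ∃ C : ℝ, 0 < C ∧ ∀ F : 𝔼 → ℂ, Continuous F → ∀ (K : Set 𝔼),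
      (∀ x ∈ K, ∀ᶠ y in nhds x, F y = 0) → ∀ (p : 𝔼) (t : ℝ), 0 < t →
      (⨍⁻ z in Metric.ball p (2 * t), ‖F z‖ₑ ∂volume) ^ 2 *
          rieszCapacity d s (K ∩ Metric.ball p t) ≤
        ENNReal.ofReal C * ∫⁻ y in Metric.ball p (2 * t), ∫⁻ z in Metric.ball p (2 * t),
          gagliardoDensity s F y z := by
  obtain ⟨C, hC, hB⟩ := laverage_ball_enorm_le_rieszPotential (d := d) hs hsd
  refine ⟨C ^ 2, by positivity, fun F hF K hK p t ht => ?_⟩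
  set a := ⨍⁻ z in Metric.ball p (2 * t), ‖F z‖ₑ ∂volume with ha
  rcases eq_or_ne a 0 with h0 | h0
  · simp [h0]
  have hatop : a ≠ ⊤ := by
    refine (setLAverage_lt_top ?_).ne
    have : IntegrableOn F (Metric.ball p (2 * t)) :=
      (hF.continuousOn.integrableOn_compact (isCompact_closedBall p (2 * t))).mono_set
        Metric.ball_subset_closedBall
    exact this.2.ne
  set g := nonlocalGradient s F (Metric.ball p (2 * t)) with hg
  have hgm : Measurable g := measurable_nonlocalGradient hF.measurable measurableSet_ball
  have hcap : rieszCapacity d s (K ∩ Metric.ball p t) ≤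
      ∫⁻ y, (ENNReal.ofReal C * a⁻¹ * g y) ^ 2 := by
    refine iInf_le_of_le (fun y => ENNReal.ofReal C * a⁻¹ * g y) <| iInf_le_of_le
      (hgm.const_mul _).aemeasurable <| iInf_le_of_le (fun x hx => ?_) le_rfl
    have hpot : rieszPotential d s (fun y => ENNReal.ofReal C * a⁻¹ * g y) x =
        a⁻¹ * (ENNReal.ofReal C * rieszPotential d s g x) := by
      rw [rieszPotential, rieszPotential, ← mul_assoc, mul_comm a⁻¹, ← lintegral_const_mul']
      · simp_rw [mul_assoc]
      · exact ENNReal.mul_ne_top ENNReal.ofReal_ne_top (ENNReal.inv_ne_top.2 h0)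
    rw [hpot, ← ENNReal.inv_mul_cancel h0 hatop]
    exact mul_le_mul' le_rfl (hB F hF.measurable p x t hx.2 (hK x hx.1))
  calc a ^ 2 * rieszCapacity d s (K ∩ Metric.ball p t)
      ≤ a ^ 2 * ∫⁻ y, (ENNReal.ofReal C * a⁻¹ * g y) ^ 2 := mul_le_mul' le_rfl hcap
    _ = ENNReal.ofReal (C ^ 2) * ∫⁻ y, g y ^ 2 := by
        simp_rw [mul_pow]
        rw [lintegral_const_mul _ (hgm.pow_const 2), ← mul_assoc, mul_left_comm, ← mul_pow a,
          ENNReal.mul_inv_cancel h0 hatop, one_pow, mul_one, ENNReal.ofReal_pow hC.le]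
    _ = _ := by rw [hg, lintegral_nonlocalGradient_sq F measurableSet_ball]

/-- The local capacitary Poincaré inequality: `F` vanishes on a uniformly fat set containing
the centre of the ball. -/
theorem setLIntegral_ball_enorm_sq_le (hs : 0 < s) (hsd : s < (d : ℝ)) {K : Set 𝔼}
    (hfat : IsUniformlyFat d s K) :
    ∃ C : ℝ, 0 < C ∧ ∀ F : 𝔼 → ℂ, Continuous F →
      (∀ x ∈ K, ∀ᶠ y in nhds x, F y = 0) → ∀ p ∈ K, ∀ t : ℝ, 0 < t →
      ∫⁻ z in Metric.ball p (2 * t), ‖F z‖ₑ ^ 2 ≤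
        ENNReal.ofReal (C * t ^ (2 * s)) *
          ∫⁻ y in Metric.ball p (2 * t), ∫⁻ z in Metric.ball p (2 * t),
            gagliardoDensity s F y z := by
  obtain ⟨c, hc, hcap⟩ := hfat
  obtain ⟨C₁, hC₁, hB⟩ := laverage_sq_mul_rieszCapacity_le (d := d) hs hsd
  obtain ⟨C₂, hC₂, hA⟩ := laverage_ball_enorm_sub_le (d := d) hs
  set v : ℝ := (volume : Measure 𝔼).real (Metric.ball 0 1) with hv
  have hv0 : 0 < v := volume_real_ball_pos
  refine ⟨2 * (2 ^ d * v * (c⁻¹ * C₁)) + 2 * (C₂ * 2 ^ s) ^ 2, by positivity,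
    fun F hF hFK p hp t ht => ?_⟩
  set B := Metric.ball p (2 * t) with hBdef
  set a := ⨍⁻ z in B, ‖F z‖ₑ ∂volume with ha
  set g := nonlocalGradient s F B with hg
  set I := ∫⁻ y in B, ∫⁻ z in B, gagliardoDensity s F y z with hI
  have hgm : Measurable g := measurable_nonlocalGradient hF.measurable measurableSet_ball
  have hp1 := isProbabilityMeasure_restrict_ball p (R := 2 * t) (by positivity)
  have ha2 : a ^ 2 ≤ ENNReal.ofReal (c⁻¹ * t ^ (2 * s - (d : ℝ)) * C₁) * I := by
    have h1 := (mul_le_mul' (le_refl (a ^ 2)) (hcap p hp t ht)).trans (hB F hF K hFK p t ht)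
    rw [← hBdef, ← hI] at h1
    have hpos : 0 < c * t ^ ((d : ℝ) - 2 * s) := by positivity
    have h2 : a ^ 2 = a ^ 2 * ENNReal.ofReal (c * t ^ ((d : ℝ) - 2 * s)) *
        ENNReal.ofReal (c * t ^ ((d : ℝ) - 2 * s))⁻¹ := by
      rw [mul_assoc, ← ENNReal.ofReal_mul hpos.le, mul_inv_cancel₀ hpos.ne', ENNReal.ofReal_one,
        mul_one]
    rw [h2]
    refine (mul_le_mul' h1 le_rfl).trans (le_of_eq ?_)
    rw [mul_right_comm, ← ENNReal.ofReal_mul hC₁.le, mul_inv, ← Real.rpow_neg ht.le, neg_sub]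
    congr 2
    ring
  have hpt : ∀ z ∈ B, ‖F z‖ₑ ^ 2 ≤
      2 * a ^ 2 + 2 * (ENNReal.ofReal (C₂ * (2 * t) ^ s) ^ 2 * g z ^ 2) := fun z hz => by
    have h1 : ‖F z‖ₑ ≤ a + ENNReal.ofReal (C₂ * (2 * t) ^ s) * g z := by
      calc ‖F z‖ₑ = ⨍⁻ _ in B, ‖F z‖ₑ ∂volume :=
            (setLAverage_const (Metric.measure_ball_pos _ _ (by positivity)).ne'
              measure_ball_lt_top.ne _).symm
        _ ≤ ⨍⁻ y in B, (‖F y‖ₑ + ‖F z - F y‖ₑ) ∂volume := by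
            refine lintegral_mono fun y => ?_
            simpa using enorm_add_le (F y) (F z - F y)
        _ = a + ⨍⁻ y in B, ‖F z - F y‖ₑ ∂volume := by
            rw [laverage, lintegral_add_left hF.measurable.enorm]; rfl
        _ ≤ _ := add_le_add le_rfl (hA F hF.measurable p (2 * t) B subset_rfl z hz)
    calc ‖F z‖ₑ ^ 2 ≤ (a + ENNReal.ofReal (C₂ * (2 * t) ^ s) * g z) ^ 2 := by gcongr
      _ ≤ 2 * (a ^ 2 + (ENNReal.ofReal (C₂ * (2 * t) ^ s) * g z) ^ 2) := ennreal_add_sq_le_two_mul _ _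
      _ = _ := by rw [mul_add, mul_pow]
  calc ∫⁻ z in B, ‖F z‖ₑ ^ 2
      ≤ ∫⁻ z in B, (2 * a ^ 2 + 2 * (ENNReal.ofReal (C₂ * (2 * t) ^ s) ^ 2 * g z ^ 2)) :=
        setLIntegral_mono' measurableSet_ball hpt
    _ = 2 * a ^ 2 * volume B +
          2 * (ENNReal.ofReal (C₂ * (2 * t) ^ s) ^ 2 * ∫⁻ z in B, g z ^ 2) := by
        rw [lintegral_add_left measurable_const, setLIntegral_const,
          lintegral_const_mul _ ((hgm.pow_const 2).const_mul _),
          lintegral_const_mul _ (hgm.pow_const 2)]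
    _ ≤ 2 * (ENNReal.ofReal (c⁻¹ * t ^ (2 * s - (d : ℝ)) * C₁) * I) *
          ENNReal.ofReal ((2 * t) ^ d * v) +
          2 * (ENNReal.ofReal (C₂ * (2 * t) ^ s) ^ 2 * I) := by
        rw [hBdef, volume_ball_eq_ofReal p (by positivity : 0 < 2 * t), ← hBdef, ← hv]
        gcongr
        rw [hI, ← lintegral_nonlocalGradient_sq F measurableSet_ball]
        exact setLIntegral_le_lintegral _ _
    _ = _ := by
        rw [← ENNReal.ofReal_pow (by positivity), ← ENNReal.ofReal_ofNat 2]
        simp only [← mul_assoc]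
        rw [mul_right_comm, ← ENNReal.ofReal_mul (by positivity), ← ENNReal.ofReal_mul (by positivity),
          ← ENNReal.ofReal_mul (by positivity), ← add_mul,
          ← ENNReal.ofReal_add (by positivity) (by positivity)]
        congr 2
        rw [Real.mul_rpow zero_le_two ht.le, Real.rpow_sub ht, Real.rpow_natCast, mul_comm 2 s,
          Real.rpow_mul ht.le, Real.rpow_ofNat]
        rw [show (OfNat.ofNat 2 : ℝ) = 2 from rfl]
        field_simp
        ring

/-! ### A weighted Hardy inequality -/

theorem lintegral_max_norm_sub_rpow_le (hd : 1 ≤ d) :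
    ∃ C : ℝ, 0 < C ∧ ∀ β : ℝ, 0 < β → β ≤ 1 → ∀ M : ℝ, 0 < M → ∀ y : 𝔼,
      ∫⁻ x : 𝔼, ENNReal.ofReal (max M ‖x - y‖ ^ (-((d : ℝ) + β))) ≤
        ENNReal.ofReal (C / β * M ^ (-β)) := by
  obtain ⟨C, hC, h⟩ := lintegral_max_one_norm_rpow_le hd
  refine ⟨C, hC, fun β hβ hβ1 M hM y => ?_⟩
  rw [lintegral_sub_right_eq_self (fun x : 𝔼 => ENNReal.ofReal (max M ‖x‖ ^ (-((d : ℝ) + β)))) y,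
    lintegral_eq_lintegral_comp_smul _ hM]
  have h1 : ∀ w : 𝔼, ENNReal.ofReal (max M ‖M • w‖ ^ (-((d : ℝ) + β))) =
      ENNReal.ofReal (M ^ (-((d : ℝ) + β))) *
        ENNReal.ofReal (max 1 ‖w‖ ^ (-((d : ℝ) + β))) := fun w => by
    rw [← ENNReal.ofReal_mul (by positivity), ← Real.mul_rpow hM.le (by positivity),
      norm_smul, Real.norm_of_nonneg hM.le, mul_max_of_nonneg _ _ hM.le, mul_one]
  simp_rw [h1]
  rw [lintegral_const_mul' _ _ ENNReal.ofReal_ne_top]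
  refine (mul_le_mul' le_rfl (mul_le_mul' le_rfl (h β hβ hβ1))).trans (le_of_eq ?_)
  rw [← ENNReal.ofReal_mul (by positivity), ← ENNReal.ofReal_mul (by positivity)]
  congr 1
  rw [neg_add, Real.rpow_add hM, Real.rpow_neg hM.le (d : ℝ), Real.rpow_natCast]
  field_simp

/-- The capacitary Poincaré inequality around the point of `K` nearest to `x`, at the scale
`dist(x, K)`. -/
theorem setLIntegral_ball_infDist_enorm_sq_le (hs : 0 < s) (hsd : s < (d : ℝ)) {K : Set 𝔼}
    (hK : IsClosed K) (hKne : K.Nonempty) (hfat : IsUniformlyFat d s K) :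
    ∃ C : ℝ, 0 < C ∧ ∀ F : 𝔼 → ℂ, Continuous F →
      (∀ x ∈ K, ∀ᶠ y in nhds x, F y = 0) → ∀ x : 𝔼, 0 < Metric.infDist x K →
      ∫⁻ y in Metric.ball x (Metric.infDist x K), ‖F y‖ₑ ^ 2 ≤
        ENNReal.ofReal (C * Metric.infDist x K ^ (2 * s)) *
          ∫⁻ q in Metric.ball x (3 * Metric.infDist x K) ×ˢ
              Metric.ball x (3 * Metric.infDist x K),
            gagliardoDensity s F q.1 q.2 ∂(volume.prod volume) := by
  obtain ⟨C, hC, h⟩ := setLIntegral_ball_enorm_sq_le hs hsd hfat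
  refine ⟨C, hC, fun F hF hFK x hx => ?_⟩
  obtain ⟨p, hp, hxp⟩ := hK.exists_infDist_eq_dist hKne x
  set δ := Metric.infDist x K with hδ
  have h1 : Metric.ball x δ ⊆ Metric.ball p (2 * δ) := Metric.ball_subset_ball' (by linarith)
  have h2 : Metric.ball p (2 * δ) ⊆ Metric.ball x (3 * δ) :=
    Metric.ball_subset_ball' (by rw [dist_comm]; linarith)
  refine (lintegral_mono_set h1).trans <| (h F hF hFK p hp δ hx).trans ?_
  refine mul_le_mul' le_rfl ?_
  rw [← Measure.prod_restrict,
    lintegral_prod _ (measurable_gagliardoDensity hF.measurable).aemeasurable]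
  exact (lintegral_mono_set h2).trans (lintegral_mono fun y => lintegral_mono_set h2)

theorem measurable_infDist_rpow (K : Set 𝔼) (α : ℝ) :
    Measurable fun x : 𝔼 => ENNReal.ofReal (Metric.infDist x K ^ α) :=
  ((Metric.continuous_infDist_pt K).measurable.pow_const α).ennreal_ofReal

theorem infDist_le_infDist_add_norm (K : Set 𝔼) (y x : 𝔼) :
    Metric.infDist y K ≤ Metric.infDist x K + ‖x - y‖ := by
  rw [← dist_eq_norm, dist_comm]
  exact Metric.infDist_le_infDist_add_dist

/-- Averaging over the balls `B(x, dist(x, K))` bounds a weighted `L²`-norm from above. -/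
theorem lintegral_infDist_rpow_mul_le (hs : 0 < s) {K : Set 𝔼} (hK : IsClosed K)
    (hKne : K.Nonempty) :
    ∃ C : ℝ, 0 < C ∧ ∀ β : ℝ, 0 < β → β ≤ 1 → ∀ φ : 𝔼 → ℝ≥0∞, Measurable φ →
      (∀ x ∈ K, φ x = 0) →
      ∫⁻ y, ENNReal.ofReal (Metric.infDist y K ^ (-(2 * s + β))) * φ y ≤
        ENNReal.ofReal C * ∫⁻ x, ENNReal.ofReal (Metric.infDist x K ^ (-(2 * s + β + d))) *
          ∫⁻ y in Metric.ball x (Metric.infDist x K), φ y := by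
  set v : ℝ := (volume : Measure 𝔼).real (Metric.ball 0 1) with hv
  have hv0 : 0 < v := volume_real_ball_pos
  refine ⟨v⁻¹ * 2 ^ (2 * s + 1 + 2 * d), by positivity, fun β hβ hβ1 φ hφ hφK => ?_⟩
  have hmeas : MeasurableSet {q : 𝔼 × 𝔼 | dist q.2 q.1 < Metric.infDist q.1 K} :=
    (isOpen_lt (by fun_prop)
      ((Metric.continuous_infDist_pt K).comp continuous_fst)).measurableSet
  have hswap : ∫⁻ x, ENNReal.ofReal (Metric.infDist x K ^ (-(2 * s + β + d))) *
      ∫⁻ y in Metric.ball x (Metric.infDist x K), φ y =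
      ∫⁻ y, ∫⁻ x, {q : 𝔼 × 𝔼 | dist q.2 q.1 < Metric.infDist q.1 K}.indicator
        (fun q => ENNReal.ofReal (Metric.infDist q.1 K ^ (-(2 * s + β + d))) * φ q.2) (x, y) := by
    rw [← lintegral_lintegral_swap]
    · refine lintegral_congr fun x => ?_
      rw [← lintegral_const_mul' _ _ ENNReal.ofReal_ne_top, ← lintegral_indicator measurableSet_ball]
      rfl
    · refine (Measurable.indicator ?_ hmeas).aemeasurable
      exact ((measurable_infDist_rpow K _).comp measurable_fst).mul (hφ.comp measurable_snd)
  rw [hswap, ← lintegral_const_mul' _ _ ENNReal.ofReal_ne_top]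
  refine lintegral_mono fun y => ?_
  by_cases hy : y ∈ K
  · simp [hφK y hy]
  have hδ : 0 < Metric.infDist y K := (hK.notMem_iff_infDist_pos hKne).1 hy
  set δ := Metric.infDist y K with hδdef
  -- The points `x ∈ B(y, δ/2)` have `δ/2 ≤ dist(x, K) ≤ 2δ`.
  have hlow : ∀ x, (Metric.ball y (δ / 2)).indicator
      (fun _ => ENNReal.ofReal ((2 * δ) ^ (-(2 * s + β + d))) * φ y) x ≤
      {q : 𝔼 × 𝔼 | dist q.2 q.1 < Metric.infDist q.1 K}.indicator
        (fun q => ENNReal.ofReal (Metric.infDist q.1 K ^ (-(2 * s + β + d))) * φ q.2) (x, y) :=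
      fun x => by
    by_cases hx : x ∈ Metric.ball y (δ / 2)
    swap
    · rw [Set.indicator_of_notMem hx]
      exact zero_le
    rw [Set.indicator_of_mem hx]
    rw [Metric.mem_ball, dist_eq_norm] at hx
    have h1 := infDist_le_infDist_add_norm K y x
    have h2 := infDist_le_infDist_add_norm K x y
    rw [norm_sub_rev] at h2
    have hxy : dist y x < Metric.infDist x K := by rw [dist_comm, dist_eq_norm]; linarith
    rw [Set.indicator_of_mem (show (x, y) ∈ {q : 𝔼 × 𝔼 | dist q.2 q.1 < Metric.infDist q.1 K}
      from hxy)]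
    refine mul_le_mul' (ENNReal.ofReal_le_ofReal ?_) le_rfl
    exact Real.rpow_le_rpow_of_nonpos (by dsimp only; linarith) (by dsimp only; linarith)
      (by have : (0 : ℝ) ≤ d := d.cast_nonneg
          linarith)
  refine le_trans ?_ (mul_le_mul' le_rfl (lintegral_mono hlow))
  rw [lintegral_indicator measurableSet_ball, setLIntegral_const,
    volume_ball_eq_ofReal y (by positivity : 0 < δ / 2), ← hv, mul_right_comm, ← mul_assoc]
  refine mul_le_mul' ?_ le_rfl
  rw [← ENNReal.ofReal_mul (by positivity), ← ENNReal.ofReal_mul (by positivity)]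
  refine ENNReal.ofReal_le_ofReal ?_
  have h2β : (2 : ℝ) ^ (2 * s + β + 2 * d) ≤ 2 ^ (2 * s + 1 + 2 * d) :=
    Real.rpow_le_rpow_of_exponent_le one_le_two (by linarith)
  have hmain : v⁻¹ * 2 ^ (2 * s + β + 2 * d) * ((2 * δ) ^ (-(2 * s + β + d)) * ((δ / 2) ^ d * v)) =
      δ ^ (-(2 * s + β)) := by
    rw [Real.mul_rpow zero_le_two hδ.le, div_pow, ← Real.rpow_natCast δ d,
      ← Real.rpow_natCast 2 d, show (2 : ℝ) ^ (2 * s + β + 2 * d) =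
        2 ^ (2 * s + β + d) * 2 ^ (d : ℝ) by rw [← Real.rpow_add two_pos]; congr 1; ring,
      Real.rpow_neg zero_le_two,
      show -(2 * s + β) = -(2 * s + β + d) + d by ring, Real.rpow_add hδ]
    field_simp
  rw [← hmain]
  refine mul_le_mul_of_nonneg_right ?_ (by positivity)
  exact mul_le_mul_of_nonneg_left h2β (by positivity)

/-- Hardy's inequality with an additional factor `dist(·, K)^(-β)` on both sides; the constant
is of the order `1 / β`. -/
theorem lintegral_infDist_rpow_mul_enorm_sq_le (hd : 1 ≤ d) (hs : 0 < s) (hsd : s < (d : ℝ))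
    {K : Set 𝔼} (hK : IsClosed K) (hKne : K.Nonempty) (hfat : IsUniformlyFat d s K) :
    ∃ C : ℝ, 0 < C ∧ ∀ β : ℝ, 0 < β → β ≤ 1 → ∀ F : 𝔼 → ℂ, Continuous F →
      (∀ x ∈ K, ∀ᶠ y in nhds x, F y = 0) →
      ∫⁻ y, ENNReal.ofReal (Metric.infDist y K ^ (-(2 * s + β))) * ‖F y‖ₑ ^ 2 ≤
        ENNReal.ofReal (C / β) * ∫⁻ q, gagliardoDensity s F q.1 q.2 *
          ENNReal.ofReal (max (Metric.infDist q.1 K) (Metric.infDist q.2 K) ^ (-β))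
            ∂((volume : Measure 𝔼).prod volume) := by
  obtain ⟨C₁, hC₁, h1⟩ := lintegral_infDist_rpow_mul_le hs hK hKne
  obtain ⟨C₂, hC₂, h2⟩ := setLIntegral_ball_infDist_enorm_sq_le hs hsd hK hKne hfat
  obtain ⟨C₃, hC₃, h3⟩ := lintegral_max_norm_sub_rpow_le hd
  refine ⟨C₁ * C₂ * (4 ^ ((d : ℝ) + 1) * C₃), by positivity, fun β hβ hβ1 F hF hFK => ?_⟩
  have hFK0 : ∀ x ∈ K, F x = 0 := fun x hx => (hFK x hx).self_of_nhds
  have hem := measurable_gagliardoDensity (s := s) hF.measurable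
  have hA : MeasurableSet {q : 𝔼 × 𝔼 × 𝔼 | dist q.2.1 q.1 < 3 * Metric.infDist q.1 K ∧
      dist q.2.2 q.1 < 3 * Metric.infDist q.1 K} := by
    have hc : Continuous fun q : 𝔼 × 𝔼 × 𝔼 => 3 * Metric.infDist q.1 K :=
      continuous_const.mul ((Metric.continuous_infDist_pt K).comp continuous_fst)
    exact ((isOpen_lt (by fun_prop) hc).inter (isOpen_lt (by fun_prop) hc)).measurableSet
  set A := {q : 𝔼 × 𝔼 × 𝔼 | dist q.2.1 q.1 < 3 * Metric.infDist q.1 K ∧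
      dist q.2.2 q.1 < 3 * Metric.infDist q.1 K} with hAdef
  set G : 𝔼 × 𝔼 × 𝔼 → ℝ≥0∞ := A.indicator fun q =>
    ENNReal.ofReal (Metric.infDist q.1 K ^ (-(d + β))) * gagliardoDensity s F q.2.1 q.2.2 with hG
  have hGm : Measurable G := by
    refine Measurable.indicator ?_ hA
    exact ((measurable_infDist_rpow K _).comp measurable_fst).mul (hem.comp measurable_snd)
  -- The energy over the balls `B(x, 3 dist(x, K))`.
  have hstep : ∀ x, ENNReal.ofReal (Metric.infDist x K ^ (-(2 * s + β + d))) *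
      ∫⁻ y in Metric.ball x (Metric.infDist x K), ‖F y‖ₑ ^ 2 ≤
      ENNReal.ofReal C₂ * ∫⁻ q, G (x, q) ∂((volume : Measure 𝔼).prod volume) := fun x => by
    rcases (Metric.infDist_nonneg (x := x) (s := K)).eq_or_lt with h0 | h0
    · simp [← h0]
    refine (mul_le_mul' le_rfl (h2 F hF hFK x h0)).trans (le_of_eq ?_)
    rw [← mul_assoc, ← ENNReal.ofReal_mul (by positivity),
      show Metric.infDist x K ^ (-(2 * s + β + d)) * (C₂ * Metric.infDist x K ^ (2 * s)) =
        C₂ * Metric.infDist x K ^ (-(d + β)) by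
          rw [mul_left_comm, ← Real.rpow_add h0]; congr 2; ring,
      ENNReal.ofReal_mul hC₂.le, mul_assoc, ← lintegral_const_mul' _ _ ENNReal.ofReal_ne_top,
      ← lintegral_indicator (measurableSet_ball.prod measurableSet_ball)]
    rfl
  -- For fixed `y`, `z`, the integral over the admissible centres `x`.
  have hinner : ∀ q : 𝔼 × 𝔼, ∫⁻ x, G (x, q) ≤
      ENNReal.ofReal (4 ^ ((d : ℝ) + 1) * C₃ / β) * (gagliardoDensity s F q.1 q.2 *
        ENNReal.ofReal (max (Metric.infDist q.1 K) (Metric.infDist q.2 K) ^ (-β))) := by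
    rintro ⟨y, z⟩
    set M := max (Metric.infDist y K) (Metric.infDist z K) with hM
    rcases (le_max_of_le_left Metric.infDist_nonneg : 0 ≤ M).eq_or_lt with h0 | h0
    · -- Both points lie in `K`, where `F` vanishes.
      have hy : y ∈ K := (hK.mem_iff_infDist_zero hKne).2
        (le_antisymm ((le_max_left _ _).trans h0.symm.le) Metric.infDist_nonneg)
      have hz : z ∈ K := (hK.mem_iff_infDist_zero hKne).2
        (le_antisymm ((le_max_right _ _).trans h0.symm.le) Metric.infDist_nonneg)
      have he : gagliardoDensity s F y z = 0 := by simp [gagliardoDensity, hFK0 y hy, hFK0 z hz]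
      have hG0 : ∀ x, G (x, (y, z)) = 0 := fun x => by
        rw [hG, Set.indicator_apply]
        simp [he]
      simp [hG0]
    have hpt : ∀ x, G (x, (y, z)) ≤ ENNReal.ofReal (max M ‖x - y‖ ^ (-(d + β))) *
        (ENNReal.ofReal (4 ^ ((d : ℝ) + 1)) * gagliardoDensity s F y z) := fun x => by
      by_cases hx : (x, (y, z)) ∈ A
      · rw [hG, Set.indicator_of_mem hx]
        obtain ⟨hy, hz⟩ : dist y x < 3 * Metric.infDist x K ∧ dist z x < 3 * Metric.infDist x K := hx
        rw [dist_comm, dist_eq_norm] at hy hz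
        rw [← mul_assoc, ← ENNReal.ofReal_mul (by positivity)]
        refine mul_le_mul' (ENNReal.ofReal_le_ofReal ?_) le_rfl
        have h4 : max M ‖x - y‖ / 4 ≤ Metric.infDist x K := by
          have := infDist_le_infDist_add_norm K y x
          have := infDist_le_infDist_add_norm K z x
          have h5 : max M ‖x - y‖ ≤ 4 * Metric.infDist x K :=
            max_le (max_le (by linarith) (by linarith)) (by linarith [norm_nonneg (x - y)])
          linarith
        have hm : 0 < max M ‖x - y‖ := lt_max_of_lt_left h0
        have hexp : -((d : ℝ) + β) ≤ 0 := by
          have : (0 : ℝ) ≤ d := d.cast_nonneg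
          linarith
        calc Metric.infDist x K ^ (-((d : ℝ) + β))
            ≤ (max M ‖x - y‖ / 4) ^ (-((d : ℝ) + β)) :=
              Real.rpow_le_rpow_of_nonpos (by positivity) h4 hexp
          _ = max M ‖x - y‖ ^ (-((d : ℝ) + β)) * 4 ^ ((d : ℝ) + β) := by
              rw [Real.div_rpow hm.le (by norm_num), Real.rpow_neg (by norm_num : (0 : ℝ) ≤ 4),
                div_inv_eq_mul]
          _ ≤ _ := by gcongr; norm_num
      · rw [hG, Set.indicator_of_notMem hx]
        exact zero_le
    refine (lintegral_mono hpt).trans ?_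
    rw [lintegral_mul_const _ (by fun_prop)]
    refine (mul_le_mul' (h3 β hβ hβ1 M h0 y) le_rfl).trans (le_of_eq ?_)
    rw [mul_comm (gagliardoDensity s F y z), ← mul_assoc, ← mul_assoc,
      ← ENNReal.ofReal_mul (by positivity), ← ENNReal.ofReal_mul (by positivity)]
    congr 2
    ring
  calc ∫⁻ y, ENNReal.ofReal (Metric.infDist y K ^ (-(2 * s + β))) * ‖F y‖ₑ ^ 2
      ≤ ENNReal.ofReal C₁ * ∫⁻ x, ENNReal.ofReal (Metric.infDist x K ^ (-(2 * s + β + d))) *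
          ∫⁻ y in Metric.ball x (Metric.infDist x K), ‖F y‖ₑ ^ 2 :=
        h1 β hβ hβ1 (fun y => ‖F y‖ₑ ^ 2) (hF.measurable.enorm.pow_const 2)
          fun x hx => by simp [hFK0 x hx]
    _ ≤ ENNReal.ofReal C₁ * ∫⁻ x, ENNReal.ofReal C₂ *
          ∫⁻ q, G (x, q) ∂((volume : Measure 𝔼).prod volume) :=
        mul_le_mul' le_rfl (lintegral_mono hstep)
    _ = ENNReal.ofReal C₁ * (ENNReal.ofReal C₂ *
          ∫⁻ q, (∫⁻ x, G (x, q)) ∂((volume : Measure 𝔼).prod volume)) := by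
        rw [lintegral_const_mul' _ _ ENNReal.ofReal_ne_top, lintegral_lintegral_swap]
        exact hGm.aemeasurable
    _ ≤ ENNReal.ofReal C₁ * (ENNReal.ofReal C₂ * ∫⁻ q,
          ENNReal.ofReal (4 ^ ((d : ℝ) + 1) * C₃ / β) * (gagliardoDensity s F q.1 q.2 *
            ENNReal.ofReal (max (Metric.infDist q.1 K) (Metric.infDist q.2 K) ^ (-β)))
            ∂((volume : Measure 𝔼).prod volume)) :=
        mul_le_mul' le_rfl (mul_le_mul' le_rfl (lintegral_mono hinner))
    _ = _ := by
        rw [lintegral_const_mul' _ _ ENNReal.ofReal_ne_top, ← mul_assoc, ← mul_assoc,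
          ← ENNReal.ofReal_mul (by positivity), ← ENNReal.ofReal_mul (by positivity)]
        congr 2
        ring

/-! ### Removing the weight by absorption -/

/-- The kernel `log²(1 + |y - z| / dist(y, K)) / |y - z|^(2s+d)`, which dominates the energy
density of small powers of `dist(·, K)`. -/
noncomputable def logKernel (s : ℝ) (K : Set 𝔼) (y z : 𝔼) : ℝ≥0∞ :=
  ENNReal.ofReal (Real.log (1 + ‖y - z‖ / Metric.infDist y K) ^ 2) / ‖y - z‖ₑ ^ (2 * s + (d : ℝ))

theorem measurable_logKernel (K : Set 𝔼) :
    Measurable fun q : 𝔼 × 𝔼 => logKernel s K q.1 q.2 := by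
  have := ((Metric.continuous_infDist_pt K).comp (continuous_fst (X := 𝔼) (Y := 𝔼))).measurable
  simp only [Function.comp_def] at this
  unfold logKernel
  fun_prop

theorem lintegral_logKernel (hs : 0 < s) (K : Set 𝔼) (y : 𝔼) (hy : 0 < Metric.infDist y K) :
    ∫⁻ z, logKernel s K y z = ENNReal.ofReal (Metric.infDist y K ^ (-(2 * s))) *
      ∫⁻ w : 𝔼, ENNReal.ofReal (Real.log (1 + ‖w‖) ^ 2 * ‖w‖ ^ (-((d : ℝ) + 2 * s))) := by
  set δ := Metric.infDist y K with hδ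
  have h1 : ∫⁻ z, logKernel s K y z = ∫⁻ w : 𝔼,
      ENNReal.ofReal (Real.log (1 + ‖w‖ / δ) ^ 2) / ‖w‖ₑ ^ (2 * s + (d : ℝ)) :=
    lintegral_sub_left_eq_self (fun w : 𝔼 =>
      ENNReal.ofReal (Real.log (1 + ‖w‖ / δ) ^ 2) / ‖w‖ₑ ^ (2 * s + (d : ℝ))) y
  rw [h1, lintegral_eq_lintegral_comp_smul _ hy, ← lintegral_const_mul' _ _ ENNReal.ofReal_ne_top,
    ← lintegral_const_mul' _ _ ENNReal.ofReal_ne_top]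
  refine lintegral_congr fun w => ?_
  rcases eq_or_ne w 0 with rfl | hw
  · simp
  have hw0 : 0 < ‖w‖ := norm_pos_iff.2 hw
  have hsd : 0 < 2 * s + (d : ℝ) := by positivity
  rw [← ofReal_norm, norm_smul, Real.norm_of_nonneg hy.le, mul_div_cancel_left₀ _ hy.ne',
    ENNReal.ofReal_rpow_of_pos (by positivity), ← ENNReal.ofReal_div_of_pos (by positivity),
    ← ENNReal.ofReal_mul (by positivity), ← ENNReal.ofReal_mul (by positivity)]
  congr 1
  rw [Real.mul_rpow hy.le hw0.le, Real.rpow_neg hw0.le, Real.rpow_neg hy.le, Real.rpow_add hy,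
    add_comm (d : ℝ), Real.rpow_natCast]
  field_simp

/-- The increment of a small power of the distance carries a factor `β / 2`. -/
theorem rpow_sub_rpow_le_mul_log {a b ρ β : ℝ} (ha : 0 < a) (hab : a ≤ b) (hbρ : b ≤ a + ρ)
    (hβ : 0 < β) : b ^ (β / 2) - a ^ (β / 2) ≤ b ^ (β / 2) * (β / 2 * Real.log (1 + ρ / a)) := by
  have hb : 0 < b := ha.trans_le hab
  have h1 : a ^ (β / 2) = b ^ (β / 2) * (a / b) ^ (β / 2) := by
    rw [Real.div_rpow ha.le hb.le]
    field_simp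
  have h2 : 1 - β / 2 * Real.log (1 + ρ / a) ≤ (a / b) ^ (β / 2) := by
    rw [Real.rpow_def_of_pos (by positivity)]
    have h3 := Real.add_one_le_exp (Real.log (a / b) * (β / 2))
    have h4 : -Real.log (a / b) ≤ Real.log (1 + ρ / a) := by
      rw [← Real.log_inv, inv_div]
      refine Real.log_le_log (by positivity) ?_
      rw [div_le_iff₀ ha]
      field_simp
      linarith
    nlinarith
  rw [h1]
  nlinarith [Real.rpow_pos_of_pos hb (β / 2)]

theorem norm_infDist_rpow_smul_sub_le {K : Set 𝔼} {f : 𝔼 → ℂ} (hK : IsClosed K)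
    (hKne : K.Nonempty) (hf : ∀ x ∈ K, f x = 0) {β : ℝ} (hβ : 0 < β) (y z : 𝔼)
    (hyz : Metric.infDist y K ≤ Metric.infDist z K) :
    ‖Metric.infDist y K ^ (β / 2) • f y - Metric.infDist z K ^ (β / 2) • f z‖ ≤
      Metric.infDist z K ^ (β / 2) *
        (‖f y - f z‖ + β / 2 * (‖f y‖ * Real.log (1 + ‖y - z‖ / Metric.infDist y K))) := by
  set a := Metric.infDist y K with ha
  set b := Metric.infDist z K with hb
  have hbβ : 0 ≤ b ^ (β / 2) := Real.rpow_nonneg Metric.infDist_nonneg _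
  rcases (Metric.infDist_nonneg : 0 ≤ a).eq_or_lt with h0 | h0
  · have hy : f y = 0 := hf y ((hK.mem_iff_infDist_zero hKne).2 h0.symm)
    simp [hy, abs_of_nonneg hbβ]
  have hba : b ≤ a + ‖y - z‖ := infDist_le_infDist_add_norm K z y
  have hmono : a ^ (β / 2) ≤ b ^ (β / 2) := by gcongr
  have hsplit : a ^ (β / 2) • f y - b ^ (β / 2) • f z =
      b ^ (β / 2) • (f y - f z) - (b ^ (β / 2) - a ^ (β / 2)) • f y := by
    rw [smul_sub, sub_smul]; abel
  rw [hsplit]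
  refine (norm_sub_le _ _).trans ?_
  rw [norm_smul, norm_smul, Real.norm_of_nonneg hbβ, Real.norm_of_nonneg (sub_nonneg.2 hmono)]
  have := mul_le_mul_of_nonneg_right (rpow_sub_rpow_le_mul_log h0 hyz hba hβ) (norm_nonneg (f y))
  linarith

theorem gagliardoDensity_infDist_rpow_smul_le_of_le {K : Set 𝔼} {f : 𝔼 → ℂ} (hK : IsClosed K)
    (hKne : K.Nonempty) (hf : ∀ x ∈ K, f x = 0) {β : ℝ} (hβ : 0 < β) (y z : 𝔼)
    (hyz : Metric.infDist y K ≤ Metric.infDist z K) :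
    gagliardoDensity s (fun x => Metric.infDist x K ^ (β / 2) • f x) y z *
        ENNReal.ofReal (Metric.infDist z K ^ (-β)) ≤
      2 * gagliardoDensity s f y z +
        ENNReal.ofReal (β ^ 2 / 2) * (‖f y‖ₑ ^ 2 * logKernel s K y z) := by
  have key := norm_infDist_rpow_smul_sub_le hK hKne hf hβ y z hyz
  set a := Metric.infDist y K with ha
  set b := Metric.infDist z K with hb
  have hreal : ‖a ^ (β / 2) • f y - b ^ (β / 2) • f z‖ ^ 2 * b ^ (-β) ≤
      2 * ‖f y - f z‖ ^ 2 +
        β ^ 2 / 2 * (‖f y‖ ^ 2 * Real.log (1 + ‖y - z‖ / a) ^ 2) := by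
    rcases (Metric.infDist_nonneg : 0 ≤ b).eq_or_lt with h0 | h0
    · rw [← hb] at h0
      rw [← h0, Real.zero_rpow (neg_ne_zero.2 hβ.ne'), mul_zero]
      positivity
    rw [← hb] at h0
    set P := ‖f y - f z‖
    set Q := ‖f y‖ * Real.log (1 + ‖y - z‖ / a) with hQ
    have h1 : ‖a ^ (β / 2) • f y - b ^ (β / 2) • f z‖ ^ 2 ≤
        b ^ β * (P + β / 2 * Q) ^ 2 := by
      refine (pow_le_pow_left₀ (norm_nonneg _) key 2).trans (le_of_eq ?_)
      rw [mul_pow, ← Real.rpow_natCast (b ^ (β / 2)) 2, ← Real.rpow_mul h0.le]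
      congr 2
      push_cast; ring
    calc _ ≤ b ^ β * (P + β / 2 * Q) ^ 2 * b ^ (-β) := by gcongr
      _ = (P + β / 2 * Q) ^ 2 := by
        rw [mul_right_comm, ← Real.rpow_add h0, add_neg_cancel, Real.rpow_zero, one_mul]
      _ ≤ 2 * P ^ 2 + β ^ 2 / 2 * Q ^ 2 := by nlinarith [sq_nonneg (P - β / 2 * Q)]
      _ = _ := by rw [hQ, mul_pow]
  have hE := ENNReal.ofReal_le_ofReal hreal
  rw [ENNReal.ofReal_mul (by positivity), ENNReal.ofReal_add (by positivity) (by positivity),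
    ENNReal.ofReal_mul zero_le_two, ENNReal.ofReal_mul (by positivity),
    ENNReal.ofReal_mul (by positivity), ENNReal.ofReal_pow (norm_nonneg _),
    ENNReal.ofReal_pow (norm_nonneg _), ENNReal.ofReal_pow (norm_nonneg _), ofReal_norm,
    ofReal_norm, ofReal_norm, ENNReal.ofReal_ofNat] at hE
  simp only [gagliardoDensity, logKernel, div_eq_mul_inv]
  rw [mul_right_comm, ← mul_assoc, ← mul_assoc (‖f y‖ₑ ^ 2), ← mul_assoc, ← add_mul]
  exact mul_le_mul' hE le_rfl

/-- Weighting `f` by a small power of the distance costs a term of the order `β²`. -/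
theorem gagliardoDensity_infDist_rpow_smul_le {K : Set 𝔼} {f : 𝔼 → ℂ} (hK : IsClosed K)
    (hKne : K.Nonempty) (hf : ∀ x ∈ K, f x = 0) {β : ℝ} (hβ : 0 < β) (y z : 𝔼) :
    gagliardoDensity s (fun x => Metric.infDist x K ^ (β / 2) • f x) y z *
        ENNReal.ofReal (max (Metric.infDist y K) (Metric.infDist z K) ^ (-β)) ≤
      2 * gagliardoDensity s f y z + ENNReal.ofReal (β ^ 2 / 2) *
        (‖f y‖ₑ ^ 2 * logKernel s K y z + ‖f z‖ₑ ^ 2 * logKernel s K z y) := by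
  rcases le_total (Metric.infDist y K) (Metric.infDist z K) with h | h
  · rw [max_eq_right h]
    refine (gagliardoDensity_infDist_rpow_smul_le_of_le hK hKne hf hβ y z h).trans ?_
    gcongr
    exact le_self_add
  · rw [max_eq_left h, gagliardoDensity_comm _ y z, gagliardoDensity_comm _ y z]
    refine (gagliardoDensity_infDist_rpow_smul_le_of_le hK hKne hf hβ z y h).trans ?_
    gcongr
    exact le_add_self

theorem lintegral_enorm_sq_mul_infDist_rpow_lt_top {K : Set 𝔼} (hK : IsClosed K)
    (hKne : K.Nonempty) {f : 𝔼 → ℂ} (hf : Continuous f) (hfc : HasCompactSupport f)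
    (hfK : tsupport f ⊆ Kᶜ) (α : ℝ) :
    ∫⁻ y, ENNReal.ofReal (Metric.infDist y K ^ α) * ‖f y‖ₑ ^ 2 < ⊤ := by
  have hpos : ∀ y ∈ tsupport f, 0 < Metric.infDist y K := fun y hy =>
    (hK.notMem_iff_infDist_pos hKne).1 (hfK hy)
  have hcont : ContinuousOn (fun y => Metric.infDist y K ^ α * ‖f y‖ ^ 2) (tsupport f) :=
    ((Metric.continuous_infDist_pt K).continuousOn.rpow_const
      fun y hy => Or.inl (hpos y hy).ne').mul (by fun_prop)
  have hint := (hcont.integrableOn_compact (μ := volume) hfc).lintegral_lt_top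
  refine lt_of_le_of_lt (le_of_eq ?_) hint
  rw [← lintegral_indicator (isClosed_tsupport f).measurableSet]
  refine lintegral_congr fun y => ?_
  by_cases hy : y ∈ tsupport f
  · rw [Set.indicator_of_mem hy, ENNReal.ofReal_mul (Real.rpow_nonneg (hpos y hy).le _),
      ENNReal.ofReal_pow (norm_nonneg _), ofReal_norm]
  · rw [Set.indicator_of_notMem hy, image_eq_zero_of_notMem_tsupport hy]
    simp

/-- Hardy's inequality for `s < 1`. In the weighted inequality applied to `dist(·, K)^(β/2) f`,
the error term is `O(β² / β)` times the left-hand side; for small `β` it is absorbed. -/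
theorem hardy_of_lt_one (hd : 1 ≤ d) (hs : 0 < s) (hs1 : s < 1) (hsd : s < (d : ℝ)) {K : Set 𝔼}
    (hK : IsClosed K) (hKne : K.Nonempty) (hfat : IsUniformlyFat d s K) :
    ∃ C : ℝ, 0 < C ∧ ∀ f : 𝔼 → ℂ, Continuous f → HasCompactSupport f → tsupport f ⊆ Kᶜ →
      ∫⁻ y, ENNReal.ofReal (Metric.infDist y K ^ (-(2 * s))) * ‖f y‖ₑ ^ 2 ≤
        ENNReal.ofReal C * ∫⁻ y, ∫⁻ z, gagliardoDensity s f y z := by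
  obtain ⟨C₀, hC₀, h0⟩ := lintegral_infDist_rpow_mul_enorm_sq_le hd hs hsd hK hKne hfat
  have hJ := lintegral_log_sq_mul_norm_rpow_lt_top hd hs hs1
  set J := ∫⁻ w : 𝔼, ENNReal.ofReal (Real.log (1 + ‖w‖) ^ 2 * ‖w‖ ^ (-((d : ℝ) + 2 * s)))
    with hJdef
  set j := J.toReal with hj
  have hj0 : 0 ≤ j := ENNReal.toReal_nonneg
  have hJj : J = ENNReal.ofReal j := (ENNReal.ofReal_toReal hJ.ne).symm
  set β : ℝ := 1 / (1 + 2 * (C₀ * j)) with hβdef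
  have hβ : 0 < β := by positivity
  have hβ1 : β ≤ 1 := by
    rw [hβdef, div_le_one (by positivity)]
    linarith [mul_nonneg hC₀.le hj0]
  have hsmall : C₀ / β * (β ^ 2 * j) ≤ 1 / 2 := by
    rw [show C₀ / β * (β ^ 2 * j) = C₀ * j * β by field_simp, hβdef, mul_one_div,
      div_le_iff₀ (by positivity)]
    linarith
  refine ⟨2 * (C₀ / β * 2), by positivity, fun f hf hfc hfK => ?_⟩
  have hfK0 : ∀ x ∈ K, ∀ᶠ y in nhds x, f y = 0 := fun x hx =>
    (notMem_tsupport_iff_eventuallyEq.1 fun h => hfK h hx)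
  have hfz : ∀ x ∈ K, f x = 0 := fun x hx => (hfK0 x hx).self_of_nhds
  set F : 𝔼 → ℂ := fun x => Metric.infDist x K ^ (β / 2) • f x with hF
  have hFc : Continuous F :=
    ((Metric.continuous_infDist_pt K).rpow_const fun _ => Or.inr (by positivity)).smul hf
  have hFK : ∀ x ∈ K, ∀ᶠ y in nhds x, F y = 0 := fun x hx => by
    filter_upwards [hfK0 x hx] with y hy
    simp [hF, hy]
  set H := ∫⁻ y, ENNReal.ofReal (Metric.infDist y K ^ (-(2 * s))) * ‖f y‖ₑ ^ 2 with hH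
  have hHtop : H ≠ ⊤ := (lintegral_enorm_sq_mul_infDist_rpow_lt_top hK hKne hf hfc hfK _).ne
  set E := ∫⁻ y, ∫⁻ z, gagliardoDensity s f y z with hE
  have hLHS : ∫⁻ y, ENNReal.ofReal (Metric.infDist y K ^ (-(2 * s + β))) * ‖F y‖ₑ ^ 2 = H := by
    refine lintegral_congr fun y => ?_
    by_cases hy : y ∈ K
    · simp [hF, hfz y hy]
    have hδ := (hK.notMem_iff_infDist_pos hKne).1 hy
    rw [hF]
    simp only
    rw [enorm_smul, mul_pow, ← mul_assoc, Real.enorm_of_nonneg (by positivity),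
      ← ENNReal.ofReal_pow (by positivity), ← ENNReal.ofReal_mul (by positivity)]
    congr 2
    rw [← Real.rpow_natCast (_ ^ (β / 2)) 2, ← Real.rpow_mul hδ.le, ← Real.rpow_add hδ]
    congr 1
    push_cast; ring
  have hem := measurable_gagliardoDensity (s := s) hf.measurable
  have hlm : Measurable fun q : 𝔼 × 𝔼 => ‖f q.1‖ₑ ^ 2 * logKernel s K q.1 q.2 :=
    ((hf.measurable.comp measurable_fst).enorm.pow_const 2).mul (measurable_logKernel K)
  have hlog : ∫⁻ q : 𝔼 × 𝔼, ‖f q.1‖ₑ ^ 2 * logKernel s K q.1 q.2 ∂(volume.prod volume) =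
      J * H := by
    rw [lintegral_prod _ hlm.aemeasurable, hH, ← lintegral_const_mul' _ _ hJ.ne]
    refine lintegral_congr fun y => ?_
    by_cases hy : y ∈ K
    · simp [hfz y hy]
    dsimp only
    rw [lintegral_const_mul' _ _ (ENNReal.pow_ne_top enorm_ne_top),
      lintegral_logKernel hs K y ((hK.notMem_iff_infDist_pos hKne).1 hy), ← hJdef]
    ring
  have hlog' : ∫⁻ q : 𝔼 × 𝔼, ‖f q.2‖ₑ ^ 2 * logKernel s K q.2 q.1 ∂(volume.prod volume) =
      J * H := by
    rw [← hlog]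
    exact lintegral_prod_swap (μ := (volume : Measure 𝔼)) (ν := (volume : Measure 𝔼))
      fun q : 𝔼 × 𝔼 => ‖f q.1‖ₑ ^ 2 * logKernel s K q.1 q.2
  have hmain : H ≤ ENNReal.ofReal (C₀ / β * 2) * E + ENNReal.ofReal (1 / 2) * H := by
    calc H ≤ ENNReal.ofReal (C₀ / β) * ∫⁻ q, gagliardoDensity s F q.1 q.2 *
          ENNReal.ofReal (max (Metric.infDist q.1 K) (Metric.infDist q.2 K) ^ (-β))
            ∂((volume : Measure 𝔼).prod volume) := hLHS ▸ h0 β hβ hβ1 F hFc hFK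
      _ ≤ ENNReal.ofReal (C₀ / β) * ∫⁻ q, (2 * gagliardoDensity s f q.1 q.2 +
          ENNReal.ofReal (β ^ 2 / 2) * (‖f q.1‖ₑ ^ 2 * logKernel s K q.1 q.2 +
            ‖f q.2‖ₑ ^ 2 * logKernel s K q.2 q.1)) ∂((volume : Measure 𝔼).prod volume) :=
          mul_le_mul' le_rfl (lintegral_mono fun q =>
            gagliardoDensity_infDist_rpow_smul_le hK hKne hfz hβ q.1 q.2)
      _ = ENNReal.ofReal (C₀ / β) * (2 * E + ENNReal.ofReal (β ^ 2 / 2) * (J * H + J * H)) := by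
          rw [lintegral_add_left (hem.const_mul 2), lintegral_const_mul _ hem,
            lintegral_const_mul' _ _ ENNReal.ofReal_ne_top, lintegral_add_left hlm, hlog, hlog',
            lintegral_prod _ hem.aemeasurable]
      _ = ENNReal.ofReal (C₀ / β * 2) * E + ENNReal.ofReal (C₀ / β * (β ^ 2 * j)) * H := by
          rw [ENNReal.ofReal_mul (by positivity), ENNReal.ofReal_mul (by positivity),
            show β ^ 2 * j = β ^ 2 / 2 * (2 * j) by ring, ENNReal.ofReal_mul (by positivity),
            ENNReal.ofReal_mul zero_le_two, ENNReal.ofReal_ofNat, hJj]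
          ring
      _ ≤ _ := by gcongr
  rw [ENNReal.ofReal_mul zero_le_two, ENNReal.ofReal_ofNat, mul_assoc]
  set X := ENNReal.ofReal (C₀ / β * 2) * E
  have hhalf : ENNReal.ofReal (1 / 2) * H + ENNReal.ofReal (1 / 2) * H = H := by
    rw [← add_mul, ← ENNReal.ofReal_add (by norm_num) (by norm_num)]
    norm_num
  have hle : ENNReal.ofReal (1 / 2) * H ≤ X := by
    have hfin : ENNReal.ofReal (1 / 2) * H ≠ ⊤ := ENNReal.mul_ne_top ENNReal.ofReal_ne_top hHtop
    refine (ENNReal.add_le_add_iff_right hfin).1 ?_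
    rw [hhalf]
    exact hmain
  calc H = ENNReal.ofReal (1 / 2) * H + ENNReal.ofReal (1 / 2) * H := hhalf.symm
    _ ≤ X + X := add_le_add hle hle
    _ = 2 * X := (two_mul X).symm

/-! ### The case `s ≥ 1` -/

theorem lintegral_lintegral_gagliardoDensity_eq {f : 𝔼 → ℂ} (hf : Measurable f) :
    ∫⁻ y, ∫⁻ x, gagliardoDensity s f x y =
      ∫⁻ w, (∫⁻ y, ‖f (w + y) - f y‖ₑ ^ 2) / ‖w‖ₑ ^ (2 * s + (d : ℝ)) := by
  have hm : Measurable fun q : 𝔼 × 𝔼 => ‖f (q.2 + q.1) - f q.1‖ₑ ^ 2 /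
      ‖q.2‖ₑ ^ (2 * s + (d : ℝ)) := by fun_prop
  calc ∫⁻ y, ∫⁻ x, gagliardoDensity s f x y
      = ∫⁻ y, ∫⁻ w, ‖f (w + y) - f y‖ₑ ^ 2 / ‖w‖ₑ ^ (2 * s + (d : ℝ)) := by
        refine lintegral_congr fun y => ?_
        rw [← lintegral_add_right_eq_self _ y]
        simp only [gagliardoDensity, add_sub_cancel_right]
    _ = ∫⁻ w, ∫⁻ y, ‖f (w + y) - f y‖ₑ ^ 2 / ‖w‖ₑ ^ (2 * s + (d : ℝ)) :=
        lintegral_lintegral_swap hm.aemeasurable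
    _ = _ := by
        refine lintegral_congr fun w => ?_
        simp only [div_eq_mul_inv]
        rw [lintegral_mul_const _ (by fun_prop)]

/-- The translation modulus `w ↦ ‖f(w + ·) - f‖₂` is subadditive, so doubling `w` multiplies its
square by at most four. -/
theorem lintegral_enorm_translate_two_smul_le {f : 𝔼 → ℂ} (hf : Measurable f) (w : 𝔼) :
    ∫⁻ y, ‖f ((2 : ℝ) • w + y) - f y‖ₑ ^ 2 ≤ 4 * ∫⁻ y, ‖f (w + y) - f y‖ₑ ^ 2 := by
  have hpt : ∀ y, ‖f ((2 : ℝ) • w + y) - f y‖ₑ ^ 2 ≤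
      2 * (‖f (w + (w + y)) - f (w + y)‖ₑ ^ 2 + ‖f (w + y) - f y‖ₑ ^ 2) := fun y => by
    rw [two_smul, add_assoc, ← sub_add_sub_cancel _ (f (w + y)) (f y)]
    calc _ ≤ (‖f (w + (w + y)) - f (w + y)‖ₑ + ‖f (w + y) - f y‖ₑ) ^ 2 := by
          gcongr
          exact enorm_add_le _ _
      _ ≤ _ := ennreal_add_sq_le_two_mul _ _
  refine (lintegral_mono hpt).trans (le_of_eq ?_)
  rw [lintegral_const_mul _ (by fun_prop), lintegral_add_left (by fun_prop),
    lintegral_add_left_eq_self (fun y => ‖f (w + y) - f y‖ₑ ^ 2) w]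
  ring

/-- For `s ≥ 1` a finite Gagliardo energy is zero: by scaling, the part of the energy coming from
increments `|w| < 2 * R` is at most the part from `|w| < R`, hence at most the part from
`|w| < R / 2 ^ n` for every `n`. -/
theorem lintegral_gagliardoDensity_eq_zero_of_one_le (hd : 1 ≤ d) (hs : 1 ≤ s) {f : 𝔼 → ℂ}
    (hf : Measurable f) (hfin : ∫⁻ y, ∫⁻ x, gagliardoDensity s f x y ≠ ⊤) :
    ∫⁻ y, ∫⁻ x, gagliardoDensity s f x y = 0 := by
  rw [lintegral_lintegral_gagliardoDensity_eq hf] at hfin ⊢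
  set h : 𝔼 → ℝ≥0∞ := fun w => (∫⁻ y, ‖f (w + y) - f y‖ₑ ^ 2) / ‖w‖ₑ ^ (2 * s + (d : ℝ)) with hh
  have hscale : ∀ w : 𝔼, ENNReal.ofReal (2 ^ d) * h ((2 : ℝ) • w) ≤ h w := fun w => by
    have h2 : ‖(2 : ℝ) • w‖ₑ ^ (2 * s + (d : ℝ)) =
        ENNReal.ofReal (2 ^ (2 * s + (d : ℝ))) * ‖w‖ₑ ^ (2 * s + (d : ℝ)) := by
      rw [enorm_smul, ENNReal.mul_rpow_of_nonneg _ _ (by positivity),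
        Real.enorm_of_nonneg zero_le_two, ENNReal.ofReal_rpow_of_pos two_pos]
    have hpos : 0 < (2 : ℝ) ^ (2 * s + (d : ℝ)) := by positivity
    simp only [hh]
    rw [h2, div_eq_mul_inv, ENNReal.mul_inv (Or.inl (by simpa using hpos))
      (Or.inl ENNReal.ofReal_ne_top), ← ENNReal.ofReal_inv_of_pos hpos, div_eq_mul_inv,
      ← mul_assoc, ← mul_assoc]
    refine mul_le_mul' ?_ le_rfl
    calc _ ≤ ENNReal.ofReal (2 ^ d) * (4 * ∫⁻ y, ‖f (w + y) - f y‖ₑ ^ 2) *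
          ENNReal.ofReal (2 ^ (2 * s + (d : ℝ)))⁻¹ := by
          gcongr
          exact lintegral_enorm_translate_two_smul_le hf w
      _ = ENNReal.ofReal (2 ^ d * 4 * (2 ^ (2 * s + (d : ℝ)))⁻¹) *
          ∫⁻ y, ‖f (w + y) - f y‖ₑ ^ 2 := by
          rw [ENNReal.ofReal_mul (by positivity), ENNReal.ofReal_mul (by positivity),
            ENNReal.ofReal_ofNat]
          ring
      _ ≤ 1 * ∫⁻ y, ‖f (w + y) - f y‖ₑ ^ 2 := by
          gcongr
          rw [ENNReal.ofReal_le_one, ← div_eq_mul_inv, div_le_one hpos, Real.rpow_add two_pos,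
            Real.rpow_natCast, mul_comm]
          gcongr
          calc (4 : ℝ) = 2 ^ (2 : ℝ) := by norm_num
            _ ≤ 2 ^ (2 * s) := Real.rpow_le_rpow_of_exponent_le one_le_two (by linarith)
      _ = _ := one_mul _
  have hdouble : ∀ R : ℝ, ∫⁻ w in Metric.ball 0 (2 * R), h w ≤ ∫⁻ w in Metric.ball 0 R, h w :=
      fun R => by
    rw [← lintegral_indicator measurableSet_ball, ← lintegral_indicator measurableSet_ball,
      lintegral_eq_lintegral_comp_smul _ two_pos, ← lintegral_const_mul' _ _ ENNReal.ofReal_ne_top]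
    refine lintegral_mono fun w => ?_
    by_cases hw : w ∈ Metric.ball 0 R
    · rw [Set.indicator_of_mem hw]
      refine le_trans ?_ (hscale w)
      exact mul_le_mul' le_rfl (Set.indicator_le_self _ _ _)
    · have hw2 : (2 : ℝ) • w ∉ Metric.ball 0 (2 * R) := by
        simpa [norm_smul] using hw
      rw [Set.indicator_of_notMem hw2, mul_zero]
      exact zero_le
  have hiter : ∀ (R : ℝ) (n : ℕ), ∫⁻ w in Metric.ball 0 R, h w ≤
      ∫⁻ w in Metric.ball 0 (R / 2 ^ n), h w := fun R n => by
    induction n with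
    | zero => simp
    | succ n ih =>
      refine ih.trans ?_
      have := hdouble (R / 2 ^ (n + 1))
      rwa [show 2 * (R / 2 ^ (n + 1)) = R / 2 ^ n by rw [pow_succ]; field_simp] at this
  have hball : ∀ R : ℝ, 0 < R → ∫⁻ w in Metric.ball 0 R, h w = 0 := fun R hR => by
    have hvol : Filter.Tendsto (fun n : ℕ => volume (Metric.ball (0 : 𝔼) (R / 2 ^ n)))
        Filter.atTop (nhds 0) := by
      have h1 : Filter.Tendsto (fun n : ℕ => (R / 2 ^ n) ^ d *
          (volume : Measure 𝔼).real (Metric.ball 0 1)) Filter.atTop (nhds 0) := by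
        have h2 : Filter.Tendsto (fun n : ℕ => R / 2 ^ n) Filter.atTop (nhds 0) := by
          have := (tendsto_pow_atTop_nhds_zero_of_lt_one (r := (2 : ℝ)⁻¹) (by norm_num)
            (by norm_num)).const_mul R
          simpa [div_eq_mul_inv] using this
        have h3 := (h2.pow d).mul_const ((volume : Measure 𝔼).real (Metric.ball 0 1))
        rwa [zero_pow (by omega), zero_mul] at h3
      have h4 := ENNReal.tendsto_ofReal h1
      rw [ENNReal.ofReal_zero] at h4
      refine h4.congr fun n => ?_
      rw [volume_ball_eq_ofReal 0 (by positivity)]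
    have hlim := tendsto_setLIntegral_zero hfin hvol
    exact le_antisymm (ge_of_tendsto' hlim (hiter R)) zero_le
  have hmono : Monotone fun n : ℕ => Metric.ball (0 : 𝔼) n := fun m n hmn =>
    Metric.ball_subset_ball (by exact_mod_cast hmn)
  rw [← setLIntegral_univ, ← Metric.iUnion_ball_nat (0 : 𝔼)]
  refine le_antisymm ((lintegral_iUnion_le _ _).trans (le_of_eq ?_)) zero_le
  rw [ENNReal.tsum_eq_zero]
  intro n
  rcases n.eq_zero_or_pos with rfl | hn
  · simp
  · exact hball n (by exact_mod_cast hn)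

theorem eq_zero_of_lintegral_gagliardoDensity_eq_zero (hd : 1 ≤ d) (hs : 0 < s) {f : 𝔼 → ℂ}
    (hf : Continuous f) (hfc : HasCompactSupport f)
    (h0 : ∫⁻ y, ∫⁻ x, gagliardoDensity s f x y = 0) (x : 𝔼) : f x = 0 := by
  have : Nontrivial 𝔼 := by
    have : Nonempty (Fin d) := ⟨⟨0, hd⟩⟩
    infer_instance
  have : NoncompactSpace 𝔼 := NormedSpace.noncompactSpace ℝ 𝔼
  have hem := measurable_gagliardoDensity (s := s) hf.measurable
  have h1 : ∫⁻ q : 𝔼 × 𝔼, gagliardoDensity s f q.1 q.2 ∂(volume.prod volume) = 0 := by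
    rw [lintegral_prod_symm _ hem.aemeasurable]
    exact h0
  rw [lintegral_eq_zero_iff hem] at h1
  have h2 : (fun q : 𝔼 × 𝔼 => f q.1) =ᵐ[volume.prod volume] fun q => f q.2 := by
    filter_upwards [h1] with q hq
    have h3 := enorm_sub_sq_eq_gagliardoDensity_mul (s := s) (by positivity) f q.1 q.2
    rw [show gagliardoDensity s f q.1 q.2 = 0 from hq, zero_mul] at h3
    simpa [sub_eq_zero] using h3
  have h4 := (Continuous.ae_eq_iff_eq (volume.prod volume) (by fun_prop) (by fun_prop)).1 h2
  obtain ⟨z, hz⟩ := (Set.ne_univ_iff_exists_notMem _).1 hfc.isCompact.ne_univ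
  rw [show f x = f z from congrFun h4 (x, z), image_eq_zero_of_notMem_tsupport hz]

end Hardy

/-! ### The inequality on the domain -/

theorem mainTheorem10 (d : ℕ) (hd : 2 ≤ d) (s : ℝ) (hs : 0 < 2 * s) (hsd : 2 * s < (d : ℝ))
    (Ξ : Set (EuclideanSpace ℝ (Fin d))) (hΞ_open : IsOpen Ξ) (hΞ_conn : IsConnected Ξ)
    (hfat : IsUniformlyFat d s Ξᶜ) :
    ∃ C : ℝ, 0 < C ∧
      ∀ f : EuclideanSpace ℝ (Fin d) → ℂ,
        ContDiff ℝ ∞ f → HasCompactSupport f → tsupport f ⊆ Ξ →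
          ∫⁻ x in Ξ, ‖f x‖ₑ ^ 2 / Metric.infEDist x (frontier Ξ) ^ (2 * s) ≤
            ENNReal.ofReal C *
              ∫⁻ y, ∫⁻ x, ‖f x - f y‖ₑ ^ 2 / ‖x - y‖ₑ ^ (2 * s + (d : ℝ)) := by
  have hs0 : 0 < s := by linarith
  have hd1 : 1 ≤ d := by omega
  rcases (Ξᶜ).eq_empty_or_nonempty with hK | hKne
  · refine ⟨1, one_pos, fun f _ _ _ => ?_⟩
    rw [Set.compl_empty_iff] at hK
    simp [hK, ENNReal.top_rpow_of_pos hs]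
  rcases le_or_gt 1 s with hs1 | hs1
  · refine ⟨1, one_pos, fun f hf hfc _ => ?_⟩
    change _ ≤ _ * ∫⁻ y, ∫⁻ x, gagliardoDensity s f x y
    rcases eq_or_ne (∫⁻ y, ∫⁻ x, gagliardoDensity s f x y) ⊤ with htop | htop
    · simp [htop]
    · have h0 := lintegral_gagliardoDensity_eq_zero_of_one_le hd1 hs1
        hf.continuous.measurable htop
      have hz := eq_zero_of_lintegral_gagliardoDensity_eq_zero hd1 hs0 hf.continuous hfc h0
      simp [hz]
  · have hK : IsClosed Ξᶜ := hΞ_open.isClosed_compl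
    obtain ⟨C, hC, h⟩ := hardy_of_lt_one hd1 hs0 hs1 (by linarith) hK hKne hfat
    refine ⟨C, hC, fun f hf hfc hfΞ => ?_⟩
    change _ ≤ _ * ∫⁻ y, ∫⁻ x, gagliardoDensity s f x y
    simp_rw [gagliardoDensity_comm f]
    refine le_trans ?_ (h f hf.continuous hfc (by rwa [compl_compl]))
    refine le_trans (setLIntegral_mono' hΞ_open.measurableSet fun x hx => ?_)
      (setLIntegral_le_lintegral Ξ _)
    have hδ : 0 < Metric.infDist x Ξᶜ :=
      (hK.notMem_iff_infDist_pos hKne).1 (Set.notMem_compl_iff.2 hx)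
    -- The boundary of `Ξ` lies in the complement, so it is at least as far away.
    have hle : ENNReal.ofReal (Metric.infDist x Ξᶜ) ≤ Metric.infEDist x (frontier Ξ) := by
      rw [Metric.infDist, ENNReal.ofReal_toReal (Metric.infEDist_ne_top hKne)]
      refine Metric.infEDist_anti ?_
      rw [hΞ_open.frontier_eq]
      exact fun y hy => hy.2
    rw [Real.rpow_neg hδ.le, ENNReal.ofReal_inv_of_pos (by positivity),
      ← ENNReal.ofReal_rpow_of_pos hδ, mul_comm _ (‖f x‖ₑ ^ 2),
      ← div_eq_mul_inv]
    gcongr
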